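/- Let $k$ be a field of characteristic zero. A Poisson algebra is a commutative $k$-algebra with a $k$-bilinear Lie bracket $\{-,-\}$ that is a derivation in each variable. For a Poisson algebra $B$, a Poisson derivation $\alpha$ of $B$ (a $k$-linear derivation of the product with $\alpha(\{a,b\})=\{\alpha(a),b\}+\{a,\alpha(b)\}$) and a $k$-linear derivation $\delta$ of $B$ with $\delta(\{a,b\})=\{\delta(a),b\}+\{a,\delta(b)\}+\alpha(a)\delta(b)-\delta(a)\alpha(b)$, let $B[x;\alpha,\delta]_p$ denote the polynomial ring $B[x]$ with the unique Poisson bracket that extends that of $B$ and satisfies $\{x,b\}=\alpha(b)x+\delta(b)$ for all $b\in B$. **Corollary 1.8.** Let $A=k[x_1][x_2;\alpha_2,\delta_2]_p\cdots[x_n;\alpha_n,\delta_n]_p$ be an iterated Poisson polynomial algebra. Suppose that a torus $H=(k^\times)^r$ acts on $A$ by Poisson automorphisms ($k$-algebra automorphisms preserving the bracket), that the action is rational (i.e. $A$ is generated as a $k$-algebra by $H$-eigenvectors whose eigenvalues are rational characters $h\mapsto h_1^{m_1}\cdots h_r^{m_r}$, $m\in\mathbb Z^r$), and that $x_1,\dots,x_n$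 are $H$-eigenvectors. Let $\mathfrak h=\operatorname{Lie}H=k^r$ act on $A$ by the differential of the $H$-action, that is, $\eta.a=\bigl(\sum_i\eta_i m_i\bigr)a$ whenever $h.a=h_1^{m_1}\cdots h_r^{m_r}a$ for all $h\in H$. Assume that there are $\eta_1,\dots,\eta_n\in\mathfrak h$ such that $\eta_i.x_j=\alpha_i(x_j)$ for all $i>j$ and such that the $\eta_i$-eigenvalue of $x_i$ is nonzero for each $i$. Then $A$ satisfies the Poisson Dixmier–Moeglin equivalence, that is, the following three sets of ideals of $A$ coincide: 1. the Poisson primitive ideals, i.e. the Poisson cores of the maximal ideals of $A$, where a Poisson ideal is an ideal $I$ with $\{A,I\}\subseteq I$ and the Poisson core of an ideal $J$ is the largest Poisson ideal contained in $J$; 2. the locally closed points of $\operatorname{P.spec}A$, the set of prime Poisson ideals of $A$ with the topology induced by the Zariski topology of $\operatorname{spec}A$; 3. the Poisson rational Poisson primes, i.e. the prime Poisson ideals $P$ such that the Poisson center $\{z\mid\{z,-\}=0\}$ of the quotient field $\operatorname{Fract}(A/P)$, with the bracket induced from $A$, is algebraic over $k$. -/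

import Mathlib

noncomputable section

/-! ### Extending derivations to the quotient field -/

/-- The extension to the quotient field `K` of `B` of a derivation from `B` to a `K`-vector
space. -/
def Derivation.extendToFractions {k B M : Type*} (K : Type*) [CommRing k] [CommRing B]
    [Algebra k B] [Field K] [Algebra B K] [IsFractionRing B K] [Algebra k K]
    [IsScalarTower k B K] [AddCommGroup M] [Module k M] [Module B M] [Module K M]
    [IsScalarTower k B M] [IsScalarTower B K M] [IsScalarTower k K M]
    (d : Derivation k B M) : Derivation k K M :=
  haveI : Algebra.FormallyEtale B K :=
    Algebra.FormallyEtale.of_isLocalization (nonZeroDivisors B)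
  ((d.liftKaehlerDifferential.liftBaseChange K) ∘ₗ
    (KaehlerDifferential.tensorKaehlerEquivOfFormallyEtale k B K).symm.toLinearMap).compDer
      (KaehlerDifferential.D k K)

theorem Derivation.extendToFractions_algebraMap {k B K M : Type*} [CommRing k] [CommRing B]
    [Algebra k B] [Field K] [Algebra B K] [IsFractionRing B K] [Algebra k K]
    [IsScalarTower k B K] [AddCommGroup M] [Module k M] [Module B M] [Module K M]
    [IsScalarTower k B M] [IsScalarTower B K M] [IsScalarTower k K M]
    (d : Derivation k B M) (b : B) : d.extendToFractions K (algebraMap B K b) = d b := by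
  have : Algebra.FormallyEtale B K :=
    Algebra.FormallyEtale.of_isLocalization (nonZeroDivisors B)
  simp [Derivation.extendToFractions,
    KaehlerDifferential.tensorKaehlerEquivOfFormallyEtale_symm_D_algebraMap]

/-- A derivation on the quotient field of `B` is determined by its values on `B`. -/
theorem Derivation.eq_of_eq_on_base {k K M : Type*} (B : Type*) [CommRing k] [CommRing B]
    [IsDomain B] [Field K] [Algebra B K] [IsFractionRing B K] [Algebra k K]
    [AddCommGroup M] [Module k M] [Module K M] {D₁ D₂ : Derivation k K M}
    (h : ∀ b : B, D₁ (algebraMap B K b) = D₂ (algebraMap B K b)) : D₁ = D₂ := by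
  ext x
  obtain ⟨a, s, hs, rfl⟩ := IsFractionRing.div_surjective (A := B) x
  have hs' : algebraMap B K s ≠ 0 := IsFractionRing.to_map_ne_zero_of_mem_nonZeroDivisors hs
  have e : algebraMap B K s * (algebraMap B K a / algebraMap B K s) = algebraMap B K a := by
    field_simp
  have h1 := D₁.leibniz (algebraMap B K s) (algebraMap B K a / algebraMap B K s)
  have h2 := D₂.leibniz (algebraMap B K s) (algebraMap B K a / algebraMap B K s)
  rw [e] at h1 h2
  rw [h a, h2, h s] at h1
  exact (smul_right_injective M hs' (add_right_cancel h1)).symm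

/-! ### Poisson brackets -/

/-- A Poisson bracket on the commutative `k`-algebra `A`: a `k`-bilinear Lie bracket that is a
derivation in each variable (in the first one by antisymmetry). -/
structure PoissonBracket (k A : Type*) [CommRing k] [CommRing A] [Algebra k A] where
  bracket : A →ₗ[k] A →ₗ[k] A
  self' : ∀ a, bracket a a = 0
  jacobi' : ∀ a b c, bracket a (bracket b c) + bracket b (bracket c a) + bracket c (bracket a b) = 0
  leibniz' : ∀ a b c, bracket a (b * c) = bracket a b * c + b * bracket a c

namespace PoissonBracket

variable {k A : Type*} [CommRing k] [CommRing A] [Algebra k A]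

variable (π : PoissonBracket k A)

theorem self (a : A) : π.bracket a a = 0 := π.self' a

theorem jacobi (a b c : A) : π.bracket a (π.bracket b c) + π.bracket b (π.bracket c a) + π.bracket c (π.bracket a b) = 0 := π.jacobi' a b c

theorem leibniz (a b c : A) : π.bracket a (b * c) = π.bracket a b * c + b * π.bracket a c := π.leibniz' a b c

theorem skew (a b : A) : π.bracket a b = -π.bracket b a := by
  have h := π.self (a + b)
  simp only [map_add, LinearMap.add_apply, π.self, zero_add, add_zero] at h
  exact eq_neg_of_add_eq_zero_right h

theorem leibniz_left (a b c : A) : π.bracket (a * b) c = a * π.bracket b c + π.bracket a c * b := by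
  rw [π.skew, π.leibniz, π.skew c a, π.skew c b]; ring

/-- The derivation `{a, -}`. -/
def ham (a : A) : Derivation k A A :=
  Derivation.mk' (π.bracket a) (fun b c => by
    simp only [smul_eq_mul]; rw [π.leibniz]; ring)

@[simp] theorem ham_apply (a b : A) : π.ham a b = π.bracket a b := rfl

/-! ### Poisson ideals, Poisson primitive ideals, the Poisson prime spectrum -/

/-- An ideal `I` with `{A, I} ⊆ I`. -/
def IsPoissonIdeal (I : Ideal A) : Prop := ∀ a, ∀ b ∈ I, π.bracket a b ∈ I

/-- The largest Poisson ideal contained in `J`. -/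
def core (J : Ideal A) : Ideal A := sSup {I | π.IsPoissonIdeal I ∧ I ≤ J}

theorem isGreatest_core (J : Ideal A) :
    IsGreatest {I | π.IsPoissonIdeal I ∧ I ≤ J} (π.core J) := by
  refine ⟨⟨fun a b hb => ?_, sSup_le fun I hI => hI.2⟩, fun I hI => le_sSup hI⟩
  unfold core at hb ⊢
  rw [sSup_eq_iSup'] at hb ⊢
  induction hb using Submodule.iSup_induction' with
  | mem I x hx =>
    have hle : I.1 ≤ ⨆ I : {I | π.IsPoissonIdeal I ∧ I ≤ J}, I.1 :=
      le_iSup (fun I : {I | π.IsPoissonIdeal I ∧ I ≤ J} => I.1) I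
    exact hle (I.2.1 a x hx)
  | zero => simp
  | add x y _ _ h1 h2 => rw [map_add]; exact add_mem h1 h2

/-- The Poisson primitive ideals are the Poisson cores of the maximal ideals. -/
def IsPoissonPrimitive (P : Ideal A) : Prop := ∃ M : Ideal A, M.IsMaximal ∧ P = π.core M

/-- The Poisson prime spectrum, with the subspace topology of the Zariski topology. -/
abbrev PSpec : Type _ := {p : PrimeSpectrum A // π.IsPoissonIdeal p.asIdeal}

/-! ### The bracket induced on a quotient -/

theorem mk_bracket_eq {I : Ideal A} (hI : π.IsPoissonIdeal I) {a a' b b' : A}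
    (ha : Ideal.Quotient.mk I a = Ideal.Quotient.mk I a')
    (hb : Ideal.Quotient.mk I b = Ideal.Quotient.mk I b') :
    Ideal.Quotient.mk I (π.bracket a b) = Ideal.Quotient.mk I (π.bracket a' b') := by
  rw [Ideal.Quotient.eq] at ha hb ⊢
  have e : π.bracket a b - π.bracket a' b' = π.bracket a (b - b') - π.bracket b' (a - a') := by
    rw [π.skew b' (a - a')]
    simp only [map_sub, LinearMap.sub_apply]
    ring
  rw [e]
  exact sub_mem (hI _ _ hb) (hI _ _ ha)

/-- The Poisson bracket on `A ⧸ I` induced by the one on `A`, for a Poisson ideal `I`. -/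
def quotient {I : Ideal A} (hI : π.IsPoissonIdeal I) : PoissonBracket k (A ⧸ I) :=
  have key : ∀ a b : A, Ideal.Quotient.mk I (π.bracket (Quotient.out (Ideal.Quotient.mk I a))
      (Quotient.out (Ideal.Quotient.mk I b))) = Ideal.Quotient.mk I (π.bracket a b) := fun a b =>
    π.mk_bracket_eq hI (Ideal.Quotient.mk_out _) (Ideal.Quotient.mk_out _)
  have hsm : ∀ (c : k) (a : A),
      c • Ideal.Quotient.mk I a = Ideal.Quotient.mk I (c • a) := fun _ _ => rfl
  have hs := Ideal.Quotient.mk_surjective (I := I)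
  { bracket := LinearMap.mk₂ k
      (fun x y => Ideal.Quotient.mk I (π.bracket (Quotient.out x) (Quotient.out y)))
      (by
        intro x y z
        obtain ⟨x, rfl⟩ := hs x
        obtain ⟨y, rfl⟩ := hs y
        obtain ⟨z, rfl⟩ := hs z
        rw [← map_add, key, key, key, ← map_add]; simp)
      (by
        intro c x y
        obtain ⟨x, rfl⟩ := hs x
        obtain ⟨y, rfl⟩ := hs y
        rw [hsm, key, key, hsm]; simp)
      (by
        intro x y z
        obtain ⟨x, rfl⟩ := hs x
        obtain ⟨y, rfl⟩ := hs y
        obtain ⟨z, rfl⟩ := hs z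
        rw [← map_add, key, key, key, ← map_add]; simp)
      (by
        intro c x y
        obtain ⟨x, rfl⟩ := hs x
        obtain ⟨y, rfl⟩ := hs y
        rw [hsm, key, key, hsm]; simp)
    self' := by
      intro x
      obtain ⟨x, rfl⟩ := hs x
      rw [LinearMap.mk₂_apply, key, π.self, map_zero]
    jacobi' := by
      intro x y z
      obtain ⟨x, rfl⟩ := hs x
      obtain ⟨y, rfl⟩ := hs y
      obtain ⟨z, rfl⟩ := hs z
      simp only [LinearMap.mk₂_apply, key]
      rw [← map_add, ← map_add, π.jacobi, map_zero]
    leibniz' := by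
      intro x y z
      obtain ⟨x, rfl⟩ := hs x
      obtain ⟨y, rfl⟩ := hs y
      obtain ⟨z, rfl⟩ := hs z
      simp only [LinearMap.mk₂_apply, ← map_mul, key]
      rw [← map_add, π.leibniz] }

theorem quotient_mk {I : Ideal A} (hI : π.IsPoissonIdeal I) (a b : A) :
    (π.quotient hI).bracket (Ideal.Quotient.mk I a) (Ideal.Quotient.mk I b) =
      Ideal.Quotient.mk I (π.bracket a b) :=
  π.mk_bracket_eq hI (Ideal.Quotient.mk_out _) (Ideal.Quotient.mk_out _)

/-! ### The bracket induced on the quotient field -/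

section Fractions

variable {B : Type*} [CommRing B] [IsDomain B] [Algebra k B] (σ : PoissonBracket k B)
  (K : Type*) [Field K] [Algebra B K] [IsFractionRing B K] [Algebra k K] [IsScalarTower k B K]

/-- The derivation of `K` extending `{b, -}`. -/
def hamFrac (b : B) : Derivation k K K :=
  ((Algebra.linearMap B K).compDer (σ.ham b)).extendToFractions K

theorem hamFrac_algebraMap (b c : B) :
    σ.hamFrac K b (algebraMap B K c) = algebraMap B K (σ.bracket b c) := by
  rw [hamFrac, Derivation.extendToFractions_algebraMap]; simp

/-- The map `b ↦ {b, -}`, as a derivation from `B` to the `K`-space of derivations of `K`. -/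
def hamFracDer : Derivation k B (Derivation k K K) :=
  Derivation.mk'
    { toFun := σ.hamFrac K
      map_add' := fun a b => Derivation.eq_of_eq_on_base B fun c => by
        simp [hamFrac_algebraMap]
      map_smul' := fun r a => Derivation.eq_of_eq_on_base B fun c => by
        rw [hamFrac_algebraMap, map_smul, LinearMap.smul_apply, RingHom.id_apply,
          Derivation.smul_apply, hamFrac_algebraMap, Algebra.smul_def, Algebra.smul_def, map_mul,
          ← IsScalarTower.algebraMap_apply] }
    (fun a b => Derivation.eq_of_eq_on_base B fun c => by
      simp [hamFrac_algebraMap, Algebra.smul_def, σ.leibniz_left, mul_comm])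

theorem hamFracDer_algebraMap (b c : B) :
    σ.hamFracDer K b (algebraMap B K c) = algebraMap B K (σ.bracket b c) :=
  σ.hamFrac_algebraMap K b c

/-- The map `x ↦ {x, -}` on `K`. -/
def fracDer : Derivation k K (Derivation k K K) := (σ.hamFracDer K).extendToFractions K

theorem fracDer_algebraMap (b c : B) :
    σ.fracDer K (algebraMap B K b) (algebraMap B K c) = algebraMap B K (σ.bracket b c) := by
  rw [fracDer, Derivation.extendToFractions_algebraMap, hamFracDer_algebraMap]

/-- Evaluation at `y` of derivation-valued derivations. -/
def evalDer (D : Derivation k K (Derivation k K K)) (y : K) : Derivation k K K :=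
  Derivation.mk' { toFun := fun x => D x y, map_add' := by simp, map_smul' := by simp }
    (fun a b => by simp)

theorem fracDer_skew (x y : K) : σ.fracDer K x y = -σ.fracDer K y x := by
  have h1 : ∀ (b : B) (y : K),
      σ.fracDer K (algebraMap B K b) y = -σ.fracDer K y (algebraMap B K b) := fun b y => by
    have : σ.fracDer K (algebraMap B K b) = -evalDer K (σ.fracDer K) (algebraMap B K b) :=
      Derivation.eq_of_eq_on_base B fun c => by
        change _ = -(σ.fracDer K (algebraMap B K c) (algebraMap B K b))
        rw [fracDer_algebraMap, fracDer_algebraMap, σ.skew, map_neg]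
    exact congrArg (fun D : Derivation k K K => D y) this
  have : σ.fracDer K x = -evalDer K (σ.fracDer K) x :=
    Derivation.eq_of_eq_on_base B fun c => by
      change _ = -(σ.fracDer K (algebraMap B K c) x)
      rw [h1 c x, neg_neg]
  exact congrArg (fun D : Derivation k K K => D y) this

theorem fracDer_self (x : K) : σ.fracDer K x x = 0 := by
  obtain ⟨a, s, hs, rfl⟩ := IsFractionRing.div_surjective (A := B) x
  have hs' : algebraMap B K s ≠ 0 := IsFractionRing.to_map_ne_zero_of_mem_nonZeroDivisors hs
  set S := algebraMap B K s
  set y := algebraMap B K a / S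
  have e : S * y = algebraMap B K a := by simp only [y]; field_simp
  have h0 : σ.fracDer K (algebraMap B K a) (algebraMap B K a) = 0 := by
    rw [fracDer_algebraMap, σ.self, map_zero]
  have hS : σ.fracDer K S S = 0 := by
    simp only [S]; rw [fracDer_algebraMap, σ.self, map_zero]
  rw [← e] at h0
  simp only [Derivation.leibniz, Derivation.add_apply, Derivation.smul_apply, smul_eq_mul,
    hS] at h0
  rw [σ.fracDer_skew K S y] at h0
  have : S * S * σ.fracDer K y y = 0 := by linear_combination h0
  simpa [hs'] using this

/-- The Jacobi sum `{x,{y,z}} + {y,{z,x}} + {z,{x,y}}`, as a derivation in `x`. -/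
def jacobiDer (y z : K) : Derivation k K K :=
  Derivation.mk'
    { toFun := fun x => σ.fracDer K x (σ.fracDer K y z) + σ.fracDer K y (σ.fracDer K z x) +
        σ.fracDer K z (σ.fracDer K x y)
      map_add' := fun a b => by simp only [map_add, Derivation.add_apply]; ring
      map_smul' := fun r a => by
        simp only [Derivation.smul_apply, Derivation.map_smul, RingHom.id_apply,
          smul_add] }
    (fun a b => by
      simp only [LinearMap.coe_mk, AddHom.coe_mk, Derivation.leibniz, Derivation.add_apply,
        Derivation.smul_apply, smul_eq_mul, map_add]
      rw [σ.fracDer_skew K a y, σ.fracDer_skew K b y]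
      simp only [map_neg]
      ring)

theorem fracDer_jacobi (x y z : K) :
    σ.fracDer K x (σ.fracDer K y z) + σ.fracDer K y (σ.fracDer K z x) +
      σ.fracDer K z (σ.fracDer K x y) = 0 := by
  have cyc : ∀ x y z : K, σ.jacobiDer K y z x = σ.jacobiDer K z x y := fun x y z => by
    change σ.fracDer K x (σ.fracDer K y z) + σ.fracDer K y (σ.fracDer K z x) +
        σ.fracDer K z (σ.fracDer K x y) =
      σ.fracDer K y (σ.fracDer K z x) + σ.fracDer K z (σ.fracDer K x y) +
        σ.fracDer K x (σ.fracDer K y z)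
    ring
  have ext0 : ∀ y z : K, (∀ b : B, σ.jacobiDer K y z (algebraMap B K b) = 0) →
      ∀ x, σ.jacobiDer K y z x = 0 := fun y z h x => by
    rw [Derivation.eq_of_eq_on_base B (D₁ := σ.jacobiDer K y z) (D₂ := 0) (by simpa using h)]
    rfl
  have h3 : ∀ b c d : B,
      σ.jacobiDer K (algebraMap B K b) (algebraMap B K c) (algebraMap B K d) = 0 :=
    fun b c d => by
      change σ.fracDer K _ (σ.fracDer K _ _) + σ.fracDer K _ (σ.fracDer K _ _) +
        σ.fracDer K _ (σ.fracDer K _ _) = 0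
      simp only [fracDer_algebraMap]
      rw [← map_add, ← map_add, σ.jacobi, map_zero]
  have h2 : ∀ (b c : B) (x : K), σ.jacobiDer K (algebraMap B K b) (algebraMap B K c) x = 0 :=
    fun b c => ext0 _ _ (h3 b c)
  have h1 : ∀ (c : B) (x y : K), σ.jacobiDer K (algebraMap B K c) x y = 0 :=
    fun c x => ext0 _ _ fun b => by rw [cyc, cyc]; exact h2 b c x
  exact ext0 y z (fun b => by rw [cyc, cyc]; exact h1 b y z) x

/-- The extension of a Poisson bracket on a domain `B` to its quotient field `K`. -/
def fractions : PoissonBracket k K where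
  bracket := LinearMap.mk₂ k (fun x y => σ.fracDer K x y) (by simp) (by simp) (by simp) (by simp)
  self' := σ.fracDer_self K
  jacobi' := σ.fracDer_jacobi K
  leibniz' a b c := by simp; ring

/-- It extends the bracket of `B`, and is the only Poisson bracket on `K` that does so. -/
theorem eq_fractions_iff (τ : PoissonBracket k K) :
    τ = σ.fractions K ↔
      ∀ b c : B, τ.bracket (algebraMap B K b) (algebraMap B K c) =
        algebraMap B K (σ.bracket b c) := by
  constructor
  · rintro rfl b c
    exact σ.fracDer_algebraMap K b c
  · intro h
    have h1 : ∀ b : B, τ.ham (algebraMap B K b) = (σ.fractions K).ham (algebraMap B K b) :=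
      fun b => Derivation.eq_of_eq_on_base B fun c =>
        (h b c).trans (σ.fracDer_algebraMap K b c).symm
    have h2 : ∀ x : K, τ.ham x = (σ.fractions K).ham x := fun x =>
      Derivation.eq_of_eq_on_base B fun c => by
        rw [ham_apply, ham_apply, τ.skew, (σ.fractions K).skew]
        exact congrArg (fun D : Derivation k K K => -D x) (h1 c)
    have h3 : τ.bracket = (σ.fractions K).bracket :=
      LinearMap.ext fun x => LinearMap.ext fun y =>
        congrArg (fun D : Derivation k K K => D y) (h2 x)
    cases τ
    cases hσ : σ.fractions K
    rw [hσ] at h3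
    cases h3
    rfl

end Fractions

/-! ### The Poisson center and the Poisson Dixmier-Moeglin equivalence -/

/-- The Poisson center `{z | {z, -} = 0}`. -/
def center : Subalgebra k A where
  carrier := {z | ∀ a, π.bracket z a = 0}
  mul_mem' {x y} hx hy a := by
    rw [π.leibniz_left, hx a, hy a, mul_zero, zero_mul, add_zero]
  add_mem' {x y} hx hy a := by
    rw [map_add, LinearMap.add_apply, hx a, hy a, add_zero]
  algebraMap_mem' r a := by
    rw [π.skew]
    exact neg_eq_zero.mpr ((π.ham a).map_algebraMap r)

/-- The Poisson bracket on the quotient field of `A ⧸ P`, for a Poisson prime `P`. -/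
def residueBracket (P : π.PSpec) : PoissonBracket k (FractionRing (A ⧸ P.1.asIdeal)) :=
  (π.quotient P.2).fractions (FractionRing (A ⧸ P.1.asIdeal))

/-- `P` is Poisson rational if the Poisson center of the quotient field of `A ⧸ P` is algebraic
over `k`. -/
def IsPoissonRational (P : π.PSpec) : Prop := Algebra.IsAlgebraic k (π.residueBracket P).center

/-- The Poisson primitive ideals, the locally closed points of the Poisson prime spectrum, and
the Poisson rational Poisson primes form the same set of ideals. -/
def DixmierMoeglinEquivalence : Prop :=
  {I : Ideal A | π.IsPoissonPrimitive I} =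
      {I | ∃ P : π.PSpec, IsLocallyClosed {P} ∧ P.1.asIdeal = I} ∧
    {I : Ideal A | ∃ P : π.PSpec, IsLocallyClosed {P} ∧ P.1.asIdeal = I} =
      {I | ∃ P : π.PSpec, π.IsPoissonRational P ∧ P.1.asIdeal = I}

/-! ### Iterated Poisson polynomial algebras -/

/-- A subalgebra closed under the bracket. -/
def IsPoissonSubalgebra (B : Subalgebra k A) : Prop :=
  ∀ a ∈ B, ∀ b ∈ B, π.bracket a b ∈ B

/-- The bracket of a Poisson subalgebra. -/
def restrict {B : Subalgebra k A} (hB : π.IsPoissonSubalgebra B) : PoissonBracket k B where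
  bracket := LinearMap.mk₂ k (fun a b => ⟨π.bracket a b, hB a a.2 b b.2⟩)
    (fun _ _ _ => Subtype.ext (by simp)) (fun _ _ _ => Subtype.ext (by simp))
    (fun _ _ _ => Subtype.ext (by simp)) (fun _ _ _ => Subtype.ext (by simp))
  self' a := Subtype.ext (π.self a)
  jacobi' a b c := Subtype.ext (π.jacobi a b c)
  leibniz' a b c := Subtype.ext (π.leibniz a b c)

/-- A derivation for the multiplication that is also a derivation for the bracket. -/
def IsPoissonDerivation (α : Derivation k A A) : Prop :=
  ∀ a b, α (π.bracket a b) = π.bracket (α a) b + π.bracket a (α b)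

/-- The conditions on `α` and `δ` under which a Poisson polynomial algebra `A[x; α, δ]` exists. -/
structure IsPoissonPolynomialDatum (α δ : Derivation k A A) : Prop where
  isPoissonDerivation : π.IsPoissonDerivation α
  map_bracket : ∀ a b, δ (π.bracket a b) =
    π.bracket (δ a) b + π.bracket a (δ b) + α a * δ b - δ a * α b

end PoissonBracket

open MvPolynomial in
/-- The polynomial algebra `k[x₀, …, xₙ₋₁]` with the bracket `π` is the iterated Poisson
polynomial algebra `k[x₀][x₁; α₁, δ₁] ⋯ [xₙ₋₁; αₙ₋₁, δₙ₋₁]`. Here `supported k (Set.Iio i)` is the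
subalgebra `k[x₀, …, xᵢ₋₁]`; it equals `k` for `i = 0`, so that `α₀` and `δ₀` are zero. -/
structure IsIteratedPoissonPolynomialAlgebra {k : Type*} [Field k] {n : ℕ}
    (π : PoissonBracket k (MvPolynomial (Fin n) k))
    (α δ : ∀ i : Fin n, Derivation k (supported k (Set.Iio i)) (supported k (Set.Iio i))) :
    Prop where
  isPoissonSubalgebra : ∀ i : Fin n, π.IsPoissonSubalgebra (supported k (Set.Iio i))
  isDatum : ∀ i : Fin n,
    (π.restrict (isPoissonSubalgebra i)).IsPoissonPolynomialDatum (α i) (δ i)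
  bracket_X : ∀ (i : Fin n) (b : supported k (Set.Iio i)),
    π.bracket (X i) (b : MvPolynomial (Fin n) k) =
      (α i b : MvPolynomial (Fin n) k) * X i + (δ i b : MvPolynomial (Fin n) k)

/-! ### Torus actions -/

/-- The algebraic torus of rank `r`, as the group of its `k`-points. -/
abbrev Torus (k : Type*) [Field k] (r : ℕ) : Type _ := Fin r → kˣ

namespace Torus

variable {k A : Type*} [Field k] [CommRing A] [Algebra k A] {r : ℕ}

/-- The rational character of the torus with exponents `m`. -/
def character (m : Fin r → ℤ) : Torus k r →* kˣ where
  toFun h := ∏ i, h i ^ m i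
  map_one' := by simp
  map_mul' h h' := by simp [mul_zpow, Finset.prod_mul_distrib]

variable (ρ : Torus k r →* (A ≃ₐ[k] A))

/-- The eigenspace of the rational character with exponents `m`. -/
def eigenspace (m : Fin r → ℤ) : Submodule k A where
  carrier := {a | ∀ h, ρ h a = (character m h : k) • a}
  add_mem' {a b} ha hb h := by rw [map_add, ha h, hb h, smul_add]
  zero_mem' h := by simp
  smul_mem' c a ha h := by rw [map_smul, ha h, smul_comm]

/-- The action is rational: `A` is generated, as an algebra, by eigenvectors whose eigenvalues are
rational characters. -/
def IsRational : Prop := Algebra.adjoin k (⋃ m, (eigenspace ρ m : Set A)) = ⊤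

/-- `a` is an eigenvector of all elements of the torus. -/
def IsEigenvector (a : A) : Prop := a ≠ 0 ∧ ∀ h, ∃ c : k, ρ h a = c • a

theorem character_injective [CharZero k] :
    Function.Injective (fun (m : Fin r → ℤ) (h : Torus k r) => (character m h : k)) := by
  intro m m' h
  funext i
  have h2 : (2 : k) ≠ 0 := two_ne_zero
  have := congrFun h (Function.update 1 i (Units.mk0 2 h2))
  have e : ∀ m : Fin r → ℤ, character m (Function.update 1 i (Units.mk0 (2 : k) h2)) =
      (Units.mk0 2 h2) ^ m i := fun m => by
    simp only [character, MonoidHom.coe_mk, OneHom.coe_mk]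
    rw [Finset.prod_eq_single i]
    · simp
    · intro j _ hj
      simp [Function.update_of_ne hj]
    · simp
  simp only [e, Units.val_zpow_eq_zpow_val, Units.val_mk0] at this
  have h' : ((2 : ℚ) ^ m i : ℚ) = 2 ^ m' i := by
    have : (((2 : ℚ) ^ m i : ℚ) : k) = ((2 ^ m' i : ℚ) : k) := by push_cast; exact this
    exact_mod_cast this
  exact zpow_right_injective₀ (by norm_num) (by norm_num) h'

theorem iSupIndep_eigenspace [CharZero k] : iSupIndep (eigenspace ρ) := by
  have h := Module.End.independent_iInf_maxGenEigenspace_of_forall_mapsTo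
    (fun h : Torus k r => (ρ h).toLinearMap) (fun h h' c =>
      Module.End.mapsTo_maxGenEigenspace_of_comm
        (by
          change (ρ h').toLinearMap * (ρ h).toLinearMap = (ρ h).toLinearMap * (ρ h').toLinearMap
          ext a
          change (ρ h' * ρ h) a = (ρ h * ρ h') a
          rw [← map_mul, ← map_mul, mul_comm]) c)
  refine (h.comp character_injective).mono fun m a ha => ?_
  simp only [Function.comp_apply, Submodule.mem_iInf]
  intro g
  refine (Module.End.mem_maxGenEigenspace _ _ _).mpr ⟨1, ?_⟩
  simp [ha g]

theorem IsRational.iSup_eigenspace {ρ : Torus k r →* (A ≃ₐ[k] A)} (hρ : IsRational ρ) :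
    ⨆ m, eigenspace ρ m = ⊤ := by
  have hle : ∀ m, eigenspace ρ m ≤ ⨆ m, eigenspace ρ m := le_iSup _
  rw [eq_top_iff]
  rintro a -
  have ha : a ∈ Algebra.adjoin k (⋃ m, (eigenspace ρ m : Set A)) := by
    rw [show Algebra.adjoin k _ = ⊤ from hρ]; trivial
  induction ha using Algebra.adjoin_induction with
  | mem x hx =>
    obtain ⟨m, hm⟩ := Set.mem_iUnion.mp hx
    exact hle m hm
  | algebraMap c =>
    refine hle 0 fun h => ?_
    simp [character]
  | add x y _ _ hx hy => exact add_mem hx hy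
  | mul x y _ _ hx hy =>
    have := Submodule.mul_mem_mul hx hy
    rw [Submodule.iSup_mul] at this
    refine (iSup_le fun m => ?_ : _ ≤ ⨆ m, eigenspace ρ m) this
    rw [Submodule.mul_iSup]
    refine iSup_le fun m' => Submodule.mul_le.mpr fun a ha b hb => hle (m + m') fun h => ?_
    rw [map_mul, ha h, hb h, smul_mul_smul_comm]
    congr 1
    simp [character, zpow_add, Finset.prod_mul_distrib]

theorem IsRational.isInternal [CharZero k] {ρ : Torus k r →* (A ≃ₐ[k] A)} (hρ : IsRational ρ) :
    DirectSum.IsInternal (eigenspace ρ) :=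
  (DirectSum.isInternal_submodule_iff_iSupIndep_and_iSup_eq_top _).mpr
    ⟨iSupIndep_eigenspace ρ, hρ.iSup_eigenspace⟩

/-- The differential of a rational torus action: the action on `A` of an element `η` of the Lie
algebra `kʳ` of the torus. On the eigenspace of the character with exponents `m` it is
multiplication by the scalar `∑ i, ηᵢ mᵢ`. -/
def differential [CharZero k] {ρ : Torus k r →* (A ≃ₐ[k] A)} (hρ : IsRational ρ)
    (η : Fin r → k) : A →ₗ[k] A :=
  (DirectSum.toModule k (Fin r → ℤ) A
    (fun m => (∑ i, η i * (m i : k)) • (eigenspace ρ m).subtype)) ∘ₗ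
  (LinearEquiv.ofBijective (DirectSum.coeLinearMap (eigenspace ρ)) hρ.isInternal).symm.toLinearMap

theorem differential_of_mem [CharZero k] {ρ : Torus k r →* (A ≃ₐ[k] A)} (hρ : IsRational ρ)
    (η : Fin r → k) {m : Fin r → ℤ} {a : A} (ha : a ∈ eigenspace ρ m) :
    differential hρ η a = (∑ i, η i * (m i : k)) • a := by
  have : (LinearEquiv.ofBijective (DirectSum.coeLinearMap (eigenspace ρ)) hρ.isInternal).symm a =
      DirectSum.lof k _ (fun m => eigenspace ρ m) m ⟨a, ha⟩ := by
    rw [LinearEquiv.symm_apply_eq]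
    exact (DirectSum.coeLinearMap_lof (eigenspace ρ) m ⟨a, ha⟩).symm
  simp only [differential, LinearMap.comp_apply, LinearEquiv.coe_coe, this,
    DirectSum.toModule_lof]
  rfl

end Torus

end

/-!
Locally closed Poisson primes are Poisson primitive by the Nullstellensatz, and Poisson primitive
ideals are Poisson rational because the Poisson center of `Fract (A ⧸ P)` embeds into the residue
field of a maximal ideal with Poisson core `P`. The remaining implication uses the torus. Its
action grades `A`. Let `P` be Poisson rational and `Q ⊋ P` a Poisson prime such that every
homogeneous element of `Q` lies in `P`, and take a shortest sum of homogeneous elements in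
`Q ∖ P`. For homogeneous `b`, the numerator of `{b, t / w}`, where `w` is the whole sum and `t` one
of its terms, is a shorter sum in `Q` and so lies in `P`. Hence `t / w` is Poisson central modulo
`P`, so it is algebraic over `k`, which puts `t` in `Q` and therefore in `P`. As `t` was any term,
`w` is in `P` too. So no `Q` of this kind exists. The homogeneous elements of any Poisson prime `Q`
lie in a Poisson prime below `Q` that is stable under `Lie H`, namely a minimal prime of the ideal
they generate. So `P` is locally closed as soon as `A` has only finitely many stable Poisson primes.

Finiteness is an induction on `n`. Over a stable prime `I` of `k[x₁, …, xᵢ₋₁]` there is at most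
one stable prime of `k[x₁, …, xᵢ]` contracting to `I`, apart from the extension of `I`. Over the
residue field of `I`, two such primes are generated by monic polynomials `f` and `g`. Put
`n = deg f * deg g` and `h = f ^ deg g - g ^ deg f`. Then `deg h < n`, but `h` is an eigenvector of
`ηᵢ` with the same eigenvalue as `xᵢ ^ n`, and `{h, b} = n αᵢ(b) h` for `b` in `k[x₁, …, xᵢ₋₁]`.
Comparing leading coefficients gives `h = 0`, because the `ηᵢ`-eigenvalue of `xᵢ` is nonzero.
-/

noncomputable section

/-- An ideal that is mapped into itself by the derivation `d`. -/
def IsDifferentialIdeal {R A : Type*} [CommRing R] [CommRing A] [Algebra R A]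
    (d : Derivation R A A) (I : Ideal A) : Prop :=
  ∀ a ∈ I, d a ∈ I

namespace IsDifferentialIdeal

variable {R A : Type*} [CommRing R] [CommRing A] [Algebra R A] {d : Derivation R A A}

theorem span {s : Set A} (hs : ∀ a ∈ s, d a ∈ Ideal.span s) :
    IsDifferentialIdeal d (Ideal.span s) := by
  intro a ha
  induction ha using Submodule.span_induction with
  | mem a ha => exact hs a ha
  | zero => simp
  | add a b _ _ ha hb => rw [map_add]; exact add_mem ha hb
  | smul c a ha' ha =>
    rw [smul_eq_mul, d.leibniz]
    exact add_mem (Ideal.mul_mem_left _ _ ha) (Ideal.mul_mem_right _ _ ha')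

theorem iterate_mem {I : Ideal A} (hI : IsDifferentialIdeal d I) {a : A} (ha : a ∈ I) (n : ℕ) :
    d^[n] a ∈ I := by
  induction n with
  | zero => exact ha
  | succ n ih => rw [Function.iterate_succ_apply']; exact hI _ ih

end IsDifferentialIdeal

theorem iterate_derivation_mul {R A : Type*} [CommRing R] [CommRing A] [Algebra R A]
    (d : Derivation R A A) (n : ℕ) (a b : A) :
    d^[n] (a * b) =
      ∑ ij ∈ Finset.HasAntidiagonal.antidiagonal n,
        (n.choose ij.1 : A) * (d^[ij.1] a * d^[ij.2] b) := by
  induction n with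
  | zero => simp
  | succ n ih =>
    rw [Finset.sum_antidiagonal_choose_succ_mul (fun i j => d^[i] a * d^[j] b),
      Function.iterate_succ_apply', ih, map_sum, ← Finset.sum_add_distrib]
    refine Finset.sum_congr rfl fun ij hij => ?_
    rw [n.choose_symm_of_eq_add (Finset.HasAntidiagonal.mem_antidiagonal.mp hij).symm]
    simp only [Derivation.leibniz, smul_eq_mul, Derivation.map_natCast,
      Function.iterate_succ_apply']
    ring

section Taylor

variable {R A : Type*} [CommRing R] [CommRing A] [Algebra R A] [Algebra ℚ A]

/-- The Taylor homomorphism `a ↦ ∑ₙ (dⁿ a / n!) Xⁿ` of a derivation `d` of a `ℚ`-algebra. The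
elements sent to power series with coefficients in an ideal `Q` form the largest ideal in `Q` that
is stable under `d`. -/
def taylorHom (d : Derivation R A A) : A →+* PowerSeries A where
  toFun a := PowerSeries.mk fun n => (n.factorial : ℚ)⁻¹ • d^[n] a
  map_one' := by
    ext (_ | n)
    · simp
    · simp [Function.iterate_succ_apply, iterate_map_zero, PowerSeries.coeff_one]
  map_mul' a b := by
    ext n
    rw [PowerSeries.coeff_mul, PowerSeries.coeff_mk, iterate_derivation_mul, Finset.smul_sum]
    refine Finset.sum_congr rfl fun ij hij => ?_
    rw [← Finset.HasAntidiagonal.mem_antidiagonal.mp hij, ← nsmul_eq_mul,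
      ← Nat.cast_smul_eq_nsmul ℚ, smul_smul, Nat.cast_add_choose, PowerSeries.coeff_mk,
      PowerSeries.coeff_mk, smul_mul_smul_comm]
    congr 1
    have := Nat.cast_ne_zero (R := ℚ).mpr (ij.1 + ij.2).factorial_ne_zero
    field_simp
  map_zero' := by ext; simp [iterate_map_zero]
  map_add' a b := by ext; simp [iterate_map_add]

theorem mem_ker_map_comp_taylorHom {d : Derivation R A A} {Q : Ideal A} {a : A} :
    a ∈ RingHom.ker ((PowerSeries.map (Ideal.Quotient.mk Q)).comp (taylorHom d)) ↔
      ∀ n, d^[n] a ∈ Q := by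
  simp only [RingHom.mem_ker, RingHom.comp_apply, PowerSeries.ext_iff, PowerSeries.coeff_map,
    map_zero, Ideal.Quotient.eq_zero_iff_mem, taylorHom, RingHom.coe_mk, MonoidHom.coe_mk,
    OneHom.coe_mk, PowerSeries.coeff_mk]
  refine forall_congr' fun n => ?_
  rw [Algebra.smul_def]
  exact Ideal.unit_mul_mem_iff_mem _
    ((IsUnit.mk0 _ (inv_ne_zero (Nat.cast_ne_zero.mpr n.factorial_ne_zero))).map _)

theorem IsDifferentialIdeal.of_mem_minimalPrimes {d : Derivation R A A} {I P : Ideal A}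
    (hI : IsDifferentialIdeal d I) (hP : P ∈ I.minimalPrimes) : IsDifferentialIdeal d P := by
  have := hP.1.1
  let J := RingHom.ker ((PowerSeries.map (Ideal.Quotient.mk P)).comp (taylorHom d))
  have hIJ : I ≤ J := fun a ha =>
    mem_ker_map_comp_taylorHom.mpr fun n => hP.1.2 (hI.iterate_mem ha n)
  have hJP : J ≤ P := fun a ha => mem_ker_map_comp_taylorHom.mp ha 0
  exact fun a ha => mem_ker_map_comp_taylorHom.mp (hP.2 ⟨RingHom.ker_isPrime _, hIJ⟩ hJP ha) 1

end Taylor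

namespace PoissonBracket

section Core

variable {k A : Type*} [Field k] [CharZero k] [CommRing A] [Algebra k A] (π : PoissonBracket k A)

theorem isPoissonIdeal_of_mem_minimalPrimes {I P : Ideal A} (hI : π.IsPoissonIdeal I)
    (hP : P ∈ I.minimalPrimes) : π.IsPoissonIdeal P := by
  let : Algebra ℚ A := Algebra.compHom A (algebraMap ℚ k)
  exact fun a => IsDifferentialIdeal.of_mem_minimalPrimes (d := π.ham a) (hI a) hP

theorem isPrime_core (Q : Ideal A) [Q.IsPrime] : (π.core Q).IsPrime := by
  obtain ⟨hcore, hle⟩ := (π.isGreatest_core Q).1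
  obtain ⟨P, hP, hPQ⟩ := Ideal.exists_minimalPrimes_le hle
  have : P ≤ π.core Q :=
    (π.isGreatest_core Q).2 ⟨π.isPoissonIdeal_of_mem_minimalPrimes hcore hP, hPQ⟩
  exact le_antisymm this hP.1.2 ▸ hP.1.1

end Core

section LocallyClosed

variable {k A : Type*} [Field k] [CommRing A] [Algebra k A] (π : PoissonBracket k A)

theorem isLocallyClosed_singleton_iff (P : π.PSpec) :
    IsLocallyClosed {P} ↔ ∃ f ∉ P.1.asIdeal, ∀ Q : π.PSpec, P.1.asIdeal ≤ Q.1.asIdeal →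
      f ∉ Q.1.asIdeal → Q = P := by
  constructor
  · rintro ⟨U, Z, hU, hZ, h⟩
    have hP : P ∈ U ∩ Z := h ▸ Set.mem_singleton P
    obtain ⟨V, hV, rfl⟩ := isOpen_induced_iff.mp hU
    obtain ⟨_, ⟨f, rfl⟩, hf, hfV⟩ :=
      PrimeSpectrum.isTopologicalBasis_basic_opens.exists_subset_of_mem_open hP.1 hV
    refine ⟨f, hf, fun Q hPQ hfQ => ?_⟩
    have hPQ' : P ⤳ Q := Topology.IsInducing.subtypeVal.specializes_iff.mp
      ((PrimeSpectrum.le_iff_specializes _ _).mp hPQ)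
    have hQ : Q ∈ (Subtype.val ⁻¹' V : Set π.PSpec) ∩ Z := ⟨hfV hfQ, hPQ'.mem_closed hZ hP.2⟩
    rwa [← h] at hQ
  · rintro ⟨f, hf, h⟩
    refine ⟨Subtype.val ⁻¹' (PrimeSpectrum.basicOpen f : Set (PrimeSpectrum A)),
      Subtype.val ⁻¹' PrimeSpectrum.zeroLocus (P.1.asIdeal : Set A),
      (PrimeSpectrum.basicOpen f).2.preimage continuous_subtype_val,
      (PrimeSpectrum.isClosed_zeroLocus _).preimage continuous_subtype_val, ?_⟩
    rw [eq_comm, Set.eq_singleton_iff_unique_mem]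
    exact ⟨⟨hf, le_refl P.1.asIdeal⟩, fun Q hQ => h Q hQ.2 hQ.1⟩

theorem isPoissonPrimitive_of_isLocallyClosed [CharZero k] [IsJacobsonRing A] {P : π.PSpec}
    (hP : IsLocallyClosed {P}) : π.IsPoissonPrimitive P.1.asIdeal := by
  obtain ⟨f, hf, h⟩ := (π.isLocallyClosed_singleton_iff P).mp hP
  have hfJ : f ∉ P.1.asIdeal.jacobson := by
    rwa [isJacobsonRing_iff_prime_eq.mp ‹_› _ P.1.isPrime]
  simp only [Ideal.jacobson, Ideal.mem_sInf, not_forall] at hfJ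
  obtain ⟨M, ⟨hPM, hM⟩, hfM⟩ := hfJ
  obtain ⟨⟨hcore, hle⟩, hgreatest⟩ := π.isGreatest_core M
  have := hM.isPrime
  let Q : π.PSpec := ⟨⟨π.core M, π.isPrime_core M⟩, hcore⟩
  have hQP : Q = P := h Q (hgreatest ⟨P.2, hPM⟩) fun hfQ => hfM (hle hfQ)
  exact ⟨M, hM, by rw [← hQP]⟩

end LocallyClosed

section Center

theorem inv_mem_center {k L : Type*} [CommRing k] [Field L] [Algebra k L]
    (τ : PoissonBracket k L) {z : L} (hz : z ∈ τ.center) : z⁻¹ ∈ τ.center := by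
  rcases eq_or_ne z 0 with rfl | hz0
  · simp
  intro a
  have h := τ.leibniz_left z z⁻¹ a
  rw [mul_inv_cancel₀ hz0, hz a, zero_mul, add_zero, τ.center.one_mem a] at h
  simpa [hz0] using h.symm

variable {k B : Type*} [Field k] [CommRing B] [IsDomain B] [Algebra k B] (σ : PoissonBracket k B)
  (K : Type*) [Field K] [Algebra B K] [IsFractionRing B K] [Algebra k K] [IsScalarTower k B K]

theorem fractions_algebraMap (b c : B) :
    (σ.fractions K).bracket (algebraMap B K b) (algebraMap B K c) =
      algebraMap B K (σ.bracket b c) :=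
  (σ.eq_fractions_iff K _).mp rfl b c

theorem mem_center_fractions_iff {z : K} :
    z ∈ (σ.fractions K).center ↔ ∀ b : B, (σ.fractions K).bracket (algebraMap B K b) z = 0 := by
  constructor
  · intro hz b
    rw [skew, hz, neg_zero]
  · intro h
    have : (σ.fractions K).ham z = 0 := Derivation.eq_of_eq_on_base B fun b => by
      rw [ham_apply, skew, h, neg_zero, Derivation.zero_apply]
    exact fun y => congrArg (· y) this

theorem exists_denominator_notMem {M : Ideal B} (hM : ∀ I, σ.IsPoissonIdeal I → I ≤ M → I = ⊥)
    {z : K} (hz : z ∈ (σ.fractions K).center) :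
    ∃ a b : B, b ∉ M ∧ algebraMap B K b * z = algebraMap B K a := by
  let denominators : Ideal B :=
    { carrier := {b | ∃ a, algebraMap B K b * z = algebraMap B K a}
      zero_mem' := ⟨0, by simp⟩
      add_mem' := by
        rintro b b' ⟨a, ha⟩ ⟨a', ha'⟩
        exact ⟨a + a', by rw [map_add, add_mul, ha, ha', map_add]⟩
      smul_mem' := by
        rintro c b ⟨a, ha⟩
        exact ⟨c * a, by rw [smul_eq_mul, map_mul, mul_assoc, ha, map_mul]⟩ }
  have hPoisson : σ.IsPoissonIdeal denominators := by
    rintro c b ⟨a, ha⟩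
    refine ⟨σ.bracket c a, ?_⟩
    rw [← fractions_algebraMap, ← fractions_algebraMap, ← ha, leibniz,
      (σ.mem_center_fractions_iff K).mp hz, mul_zero, add_zero]
  by_contra! h
  have hle : denominators ≤ M := fun b ⟨a, ha⟩ => by
    by_contra hb
    exact h a b hb ha
  obtain ⟨a, s, hs, rfl⟩ := IsFractionRing.div_surjective (A := B) z
  have hs0 : algebraMap B K s ≠ 0 := IsFractionRing.to_map_ne_zero_of_mem_nonZeroDivisors hs
  have hsI : s ∈ denominators := ⟨a, by field_simp⟩
  rw [hM _ hPoisson hle, Ideal.mem_bot] at hsI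
  exact hs0 (by rw [hsI, map_zero])

theorem isAlgebraic_center_fractions (M : Ideal B) [M.IsMaximal] [Algebra.IsAlgebraic k (B ⧸ M)]
    (hM : ∀ I, σ.IsPoissonIdeal I → I ≤ M → I = ⊥) :
    Algebra.IsAlgebraic k (σ.fractions K).center := by
  let _ : Field (B ⧸ M) := Ideal.Quotient.field M
  -- The Poisson center lies in the local ring of `M`, so it embeds in the residue field of `M`.
  let O := Localization.subalgebra.ofField K M.primeCompl M.primeCompl_le_nonZeroDivisors
  have hO : (σ.fractions K).center ≤ O.restrictScalars k := fun z hz => by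
    obtain ⟨a, b, hb, hab⟩ := σ.exists_denominator_notMem K hM hz
    have hb0 : algebraMap B K b ≠ 0 := fun h =>
      hb (by rw [(map_eq_zero_iff _ (IsFractionRing.injective B K)).mp h]; exact M.zero_mem)
    exact ⟨a, b, hb, by rw [← hab]; field_simp⟩
  have hunit (b : M.primeCompl) : IsUnit (Ideal.Quotient.mkₐ k M b) :=
    IsUnit.mk0 _ fun h => b.2 (Ideal.Quotient.eq_zero_iff_mem.mp h)
  let f : (σ.fractions K).center →ₐ[k] B ⧸ M :=
    (IsLocalization.liftAlgHom (S := O) hunit).comp (Subalgebra.inclusion hO)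
  refine Algebra.IsAlgebraic.of_injective f ((injective_iff_map_eq_zero f).mpr fun z hz => ?_)
  by_contra hz0
  have hinv : z * ⟨_, inv_mem_center _ z.2⟩ = 1 :=
    Subtype.ext (mul_inv_cancel₀ fun h => hz0 (Subtype.ext h))
  have := congrArg f hinv
  rw [map_mul, hz, zero_mul, map_one] at this
  exact zero_ne_one this

end Center

section Primitive

variable {k A : Type*} [Field k] [CommRing A] [Algebra k A] (π : PoissonBracket k A)

theorem isPoissonIdeal_comap_mk {I : Ideal A} (hI : π.IsPoissonIdeal I) {J : Ideal (A ⧸ I)}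
    (hJ : (π.quotient hI).IsPoissonIdeal J) :
    π.IsPoissonIdeal (J.comap (Ideal.Quotient.mk I)) := fun a b hb => by
  rw [Ideal.mem_comap, ← π.quotient_mk hI]
  exact hJ _ _ hb

theorem isPoissonRational_of_eq_core [Algebra.FiniteType k A] {P : π.PSpec} {M : Ideal A}
    [hM : M.IsMaximal] (hP : P.1.asIdeal = π.core M) : π.IsPoissonRational P := by
  have hPM : P.1.asIdeal ≤ M := hP ▸ (π.isGreatest_core M).1.2
  let mk := Ideal.Quotient.mk P.1.asIdeal
  have hmk : Function.Surjective mk := Ideal.Quotient.mk_surjective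
  have : (M.map mk).IsMaximal := Ideal.IsMaximal.map_of_surjective_of_ker_le hmk
    (by rwa [Ideal.mk_ker])
  let _ : Field ((A ⧸ P.1.asIdeal) ⧸ M.map mk) := Ideal.Quotient.field _
  have := finite_of_finite_type_of_isJacobsonRing k ((A ⧸ P.1.asIdeal) ⧸ M.map mk)
  refine isAlgebraic_center_fractions _ _ (M.map mk) fun I hI hIM => ?_
  have hle : I.comap mk ≤ P.1.asIdeal := ((π.isGreatest_core M).2
    ⟨π.isPoissonIdeal_comap_mk P.2 hI,
      (Ideal.comap_mono hIM).trans_eq (Ideal.comap_map_mk hPM)⟩).trans_eq hP.symm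
  rw [eq_bot_iff, ← Ideal.map_comap_of_surjective mk hmk I]
  exact (Ideal.map_mono hle).trans_eq (Ideal.map_quotient_self _)

end Primitive

end PoissonBracket

theorem mem_of_isIntegral_of_mul_eq {A K : Type*} [CommRing A] [CommRing K] [IsDomain K]
    [Algebra A K] {Q : Ideal A} [Q.IsPrime] (hQ : RingHom.ker (algebraMap A K) ≤ Q) {x : K}
    (hx : IsIntegral A x) {a c : A} (h : algebraMap A K a * x = algebraMap A K c) (ha : a ∈ Q) :
    c ∈ Q := by
  have hker : RingHom.ker (algebraMap A (integralClosure A K)) ≤ Q := fun b hb =>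
    hQ (congrArg Subtype.val hb)
  obtain ⟨Q', _, rfl⟩ := Ideal.exists_ideal_over_prime_of_isIntegral_of_isDomain Q hker
  have : algebraMap A (integralClosure A K) a * ⟨x, hx⟩ = algebraMap A _ c := Subtype.ext h
  rw [Ideal.mem_comap, ← this]
  exact Q'.mul_mem_right _ ha

namespace PoissonBracket

section Wronskian

variable {k A : Type*} [CommRing k] [CommRing A] [Algebra k A] (π : PoissonBracket k A)

/-- The Wronskian `{b, a} c - a {b, c}` of `a` and `c` with respect to `{b, -}`. It is the numerator
of `{b, a / c}` over the denominator `c ^ 2`. -/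
def wronskian (b a c : A) : A := π.bracket b a * c - a * π.bracket b c

theorem wronskian_self (b a : A) : π.wronskian b a a = 0 := by
  rw [wronskian, mul_comm, sub_self]

theorem wronskian_add_left (b b' a c : A) :
    π.wronskian (b + b') a c = π.wronskian b a c + π.wronskian b' a c := by
  simp only [wronskian, map_add, LinearMap.add_apply]
  ring

theorem wronskian_sum_right {ι : Type*} (b a : A) (s : Finset ι) (f : ι → A) :
    π.wronskian b a (∑ j ∈ s, f j) = ∑ j ∈ s, π.wronskian b a (f j) := by
  simp only [wronskian, map_sum, Finset.mul_sum, Finset.sum_sub_distrib]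

theorem wronskian_mem {I : Ideal A} (hI : π.IsPoissonIdeal I) (b a : A) {c : A} (hc : c ∈ I) :
    π.wronskian b a c ∈ I :=
  sub_mem (I.mul_mem_left _ hc) (I.mul_mem_left _ (hI b c hc))

theorem wronskian_quotient_mk {I : Ideal A} (hI : π.IsPoissonIdeal I) (b a c : A) :
    (π.quotient hI).wronskian (Ideal.Quotient.mk I b) (Ideal.Quotient.mk I a)
      (Ideal.Quotient.mk I c) = Ideal.Quotient.mk I (π.wronskian b a c) := by
  simp only [wronskian, quotient_mk, map_sub, map_mul]

end Wronskian

theorem div_mem_center_fractions {k B : Type*} [Field k] [CommRing B] [IsDomain B] [Algebra k B]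
    (σ : PoissonBracket k B) (K : Type*) [Field K] [Algebra B K] [IsFractionRing B K] [Algebra k K]
    [IsScalarTower k B K] {a c : B} (h : ∀ b, σ.wronskian b a c = 0) :
    algebraMap B K a / algebraMap B K c ∈ (σ.fractions K).center := by
  rcases eq_or_ne (algebraMap B K c) 0 with hc | hc
  · simp [hc]
  obtain ⟨z, hz⟩ : ∃ z, algebraMap B K c * z = algebraMap B K a := ⟨_, mul_div_cancel₀ _ hc⟩
  rw [← hz, mul_div_cancel_left₀ z hc, mem_center_fractions_iff]
  intro b
  have hb := congrArg (algebraMap B K) (h b)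
  rw [wronskian, map_sub, map_mul, map_mul, map_zero, ← fractions_algebraMap, ← hz, leibniz,
    fractions_algebraMap] at hb
  refine (mul_eq_zero.mp ?_).resolve_left (mul_ne_zero hc hc)
  linear_combination hb

section Rational

variable {k A : Type*} [Field k] [CommRing A] [Algebra k A] (π : PoissonBracket k A)

theorem mem_of_wronskian_mem {P : π.PSpec} (hP : π.IsPoissonRational P) {Q : Ideal A} [Q.IsPrime]
    (hPQ : P.1.asIdeal ≤ Q) {a c : A} (ha : a ∈ Q) (haP : a ∉ P.1.asIdeal)
    (h : ∀ b, π.wronskian b c a ∈ P.1.asIdeal) : c ∈ Q := by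
  let B := A ⧸ P.1.asIdeal
  let K := FractionRing B
  have hmk (x : A) : algebraMap A K x = 0 ↔ x ∈ P.1.asIdeal := by
    rw [IsScalarTower.algebraMap_apply A B K, map_eq_zero_iff _ (IsFractionRing.injective B K)]
    exact Ideal.Quotient.eq_zero_iff_mem
  have hcentral : algebraMap A K c / algebraMap A K a ∈ (π.residueBracket P).center := by
    refine div_mem_center_fractions (π.quotient P.2) K fun b => ?_
    obtain ⟨b, rfl⟩ := Ideal.Quotient.mk_surjective b
    exact (π.wronskian_quotient_mk P.2 b c a).trans (Ideal.Quotient.eq_zero_iff_mem.mpr (h b))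
  have hint : IsIntegral k (algebraMap A K c / algebraMap A K a) :=
    ((hP.isAlgebraic ⟨_, hcentral⟩).algebraMap (A := K)).isIntegral
  exact mem_of_isIntegral_of_mul_eq (fun x hx => hPQ ((hmk x).mp hx)) hint.tower_top
    (mul_div_cancel₀ _ (mt (hmk a).mp haP)) ha

/-- The bracket and the multiplication of `A` are graded by the subspaces `V m`, which span `A`.
Their sum need not be direct. -/
structure IsGradedBy {ι : Type*} [Add ι] (V : ι → Submodule k A) : Prop where
  iSup_eq_top : ⨆ m, V m = ⊤
  mul_mem : ∀ {m m' a b}, a ∈ V m → b ∈ V m' → a * b ∈ V (m + m')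
  bracket_mem : ∀ {m m' a b}, a ∈ V m → b ∈ V m' → π.bracket a b ∈ V (m + m')

variable {π} {ι : Type*} [AddCommSemigroup ι] {V : ι → Submodule k A}

theorem IsGradedBy.wronskian_mem (hV : π.IsGradedBy V) {l m n : ι} {b a c : A} (hb : b ∈ V l)
    (ha : a ∈ V m) (hc : c ∈ V n) : π.wronskian b a c ∈ V (l + m + n) := by
  refine sub_mem (hV.mul_mem (hV.bracket_mem hb ha) hc) ?_
  rw [add_comm l, add_assoc]
  exact hV.mul_mem ha (hV.bracket_mem hb hc)

theorem IsGradedBy.wronskian_mem_of_homogeneous (hV : π.IsGradedBy V) {I : Ideal A} {a c : A}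
    (h : ∀ m, ∀ b ∈ V m, π.wronskian b a c ∈ I) (b : A) : π.wronskian b a c ∈ I := by
  have hb : b ∈ ⨆ m, V m := hV.iSup_eq_top ▸ Submodule.mem_top
  induction hb using Submodule.iSup_induction' with
  | mem m b hb => exact h m b hb
  | zero => simp [wronskian]
  | add b b' _ _ hb hb' =>
    rw [wronskian_add_left]
    exact add_mem hb hb'

theorem IsGradedBy.sum_mem_of_homogeneous_le (hV : π.IsGradedBy V) {P Q : π.PSpec}
    (hP : π.IsPoissonRational P) (hPQ : P.1.asIdeal ≤ Q.1.asIdeal)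
    (h : ∀ m, ∀ a ∈ V m, a ∈ Q.1.asIdeal → a ∈ P.1.asIdeal) {κ : Type*} (s : Finset κ) :
    ∀ f : κ → A, (∀ j ∈ s, ∃ m, f j ∈ V m) → ∑ j ∈ s, f j ∈ Q.1.asIdeal →
      ∑ j ∈ s, f j ∈ P.1.asIdeal := by
  classical
  induction s using Finset.strongInduction with
  | H s ih =>
    intro f hf hQ
    by_contra hnP
    obtain ⟨i, his, hi⟩ : ∃ i ∈ s, f i ∉ P.1.asIdeal := by
      by_contra! hc
      exact hnP (sum_mem hc)
    obtain ⟨m, hm⟩ := hf i his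
    refine hi (h m _ hm (π.mem_of_wronskian_mem hP hPQ hQ hnP
      (hV.wronskian_mem_of_homogeneous fun l b hb => ?_)))
    have hmem := π.wronskian_mem Q.2 b (f i) hQ
    rw [wronskian_sum_right, ← Finset.add_sum_erase _ _ his, wronskian_self, zero_add] at hmem ⊢
    refine ih _ (Finset.erase_ssubset his) _ (fun j hj => ?_) hmem
    obtain ⟨n, hn⟩ := hf j (Finset.mem_of_mem_erase hj)
    exact ⟨l + m + n, hV.wronskian_mem hb hm hn⟩

theorem IsGradedBy.le_of_homogeneous_le (hV : π.IsGradedBy V) {P Q : π.PSpec}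
    (hP : π.IsPoissonRational P) (hPQ : P.1.asIdeal ≤ Q.1.asIdeal)
    (h : ∀ m, ∀ a ∈ V m, a ∈ Q.1.asIdeal → a ∈ P.1.asIdeal) : Q.1.asIdeal ≤ P.1.asIdeal := by
  intro a ha
  have haV : a ∈ ⨆ m, V m := hV.iSup_eq_top ▸ Submodule.mem_top
  obtain ⟨f, hf, rfl⟩ := (Submodule.mem_iSup_iff_exists_finsupp _ _).mp haV
  exact hV.sum_mem_of_homogeneous_le hP hPQ h f.support f (fun j _ => ⟨j, hf j⟩) ha

theorem IsGradedBy.isLocallyClosed_of_isPoissonRational (hV : π.IsGradedBy V) {S : Set (Ideal A)}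
    (hS : S.Finite)
    (hSQ : ∀ Q : π.PSpec, ∃ J ∈ S, J ≤ Q.1.asIdeal ∧ ∀ m, ∀ a ∈ V m, a ∈ Q.1.asIdeal → a ∈ J)
    {P : π.PSpec} (hP : π.IsPoissonRational P) : IsLocallyClosed {P} := by
  classical
  let S' := hS.toFinset.filter (¬ · ≤ P.1.asIdeal)
  have hS' : ¬ S'.inf id ≤ P.1.asIdeal := by
    rw [P.1.isPrime.inf_le']
    rintro ⟨J, hJ, hJP⟩
    exact (Finset.mem_filter.mp hJ).2 hJP
  obtain ⟨f, hf, hfP⟩ := Set.not_subset.mp hS'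
  refine (π.isLocallyClosed_singleton_iff P).mpr ⟨f, hfP, fun Q hPQ hfQ => ?_⟩
  obtain ⟨J, hJS, hJQ, hJ⟩ := hSQ Q
  have hJP : J ≤ P.1.asIdeal := by
    by_contra hJP
    have hJS' : J ∈ S' := Finset.mem_filter.mpr ⟨hS.mem_toFinset.mpr hJS, hJP⟩
    exact hfQ (hJQ (Finset.inf_le (f := id) hJS' hf))
  have hQP := hV.le_of_homogeneous_le hP hPQ fun m a ha haQ => hJP (hJ m a ha haQ)
  exact Subtype.ext (PrimeSpectrum.ext (le_antisymm hQP hPQ))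

end Rational

theorem dixmierMoeglinEquivalence_of_forall_isLocallyClosed {k A : Type*} [Field k] [CharZero k]
    [CommRing A] [Algebra k A] [Algebra.FiniteType k A] (π : PoissonBracket k A)
    (h : ∀ P : π.PSpec, π.IsPoissonRational P → IsLocallyClosed {P}) :
    π.DixmierMoeglinEquivalence := by
  have : IsJacobsonRing A := isJacobsonRing_of_finiteType (A := k)
  have hprimitive : ∀ I : Ideal A, π.IsPoissonPrimitive I →
      ∃ P : π.PSpec, π.IsPoissonRational P ∧ P.1.asIdeal = I := by
    rintro _ ⟨M, hM, rfl⟩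
    have := hM.isPrime
    exact ⟨⟨⟨π.core M, π.isPrime_core M⟩, (π.isGreatest_core M).1.1⟩,
      π.isPoissonRational_of_eq_core rfl, rfl⟩
  refine ⟨Set.ext fun I => ⟨fun hI => ?_, ?_⟩, Set.ext fun I => ⟨?_, ?_⟩⟩
  · obtain ⟨P, hP, rfl⟩ := hprimitive I hI
    exact ⟨P, h P hP, rfl⟩
  · rintro ⟨P, hP, rfl⟩
    exact π.isPoissonPrimitive_of_isLocallyClosed hP
  · rintro ⟨P, hP, rfl⟩
    exact hprimitive _ (π.isPoissonPrimitive_of_isLocallyClosed hP)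
  · rintro ⟨P, hP, rfl⟩
    exact ⟨P, h P hP, rfl⟩

end PoissonBracket

namespace Torus

variable {k A : Type*} [Field k] [CommRing A] [Algebra k A] {r : ℕ} {ρ : Torus k r →* (A ≃ₐ[k] A)}

theorem character_add (m m' : Fin r → ℤ) (h : Torus k r) :
    character (m + m') h = character m h * character m' h := by
  simp [character, zpow_add, Finset.prod_mul_distrib]

theorem mul_mem_eigenspace {m m' : Fin r → ℤ} {a b : A} (ha : a ∈ eigenspace ρ m)
    (hb : b ∈ eigenspace ρ m') : a * b ∈ eigenspace ρ (m + m') := fun h => by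
  rw [map_mul, ha h, hb h, smul_mul_smul_comm, character_add, Units.val_mul]

variable {π : PoissonBracket k A}

theorem bracket_mem_eigenspace (hρπ : ∀ h a b, ρ h (π.bracket a b) = π.bracket (ρ h a) (ρ h b))
    {m m' : Fin r → ℤ} {a b : A} (ha : a ∈ eigenspace ρ m) (hb : b ∈ eigenspace ρ m') :
    π.bracket a b ∈ eigenspace ρ (m + m') := fun h => by
  rw [hρπ, ha h, hb h, map_smul, map_smul, LinearMap.smul_apply, smul_smul, character_add,
    Units.val_mul, mul_comm]

theorem isGradedBy_eigenspace (hρ : IsRational ρ)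
    (hρπ : ∀ h a b, ρ h (π.bracket a b) = π.bracket (ρ h a) (ρ h b)) :
    π.IsGradedBy (eigenspace ρ) where
  iSup_eq_top := hρ.iSup_eigenspace
  mul_mem := mul_mem_eigenspace
  bracket_mem := bracket_mem_eigenspace hρπ

/-- The ideal generated by the eigenvectors in `I` of the rational characters. -/
def homogeneousSpan (ρ : Torus k r →* (A ≃ₐ[k] A)) (I : Ideal A) : Ideal A :=
  Ideal.span {a | a ∈ I ∧ ∃ m, a ∈ eigenspace ρ m}

theorem isPoissonIdeal_homogeneousSpan (hρ : IsRational ρ)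
    (hρπ : ∀ h a b, ρ h (π.bracket a b) = π.bracket (ρ h a) (ρ h b)) {I : Ideal A}
    (hI : π.IsPoissonIdeal I) : π.IsPoissonIdeal (homogeneousSpan ρ I) := by
  refine fun b => IsDifferentialIdeal.span (d := π.ham b) ?_
  rintro a ⟨haI, m, ha⟩
  rw [PoissonBracket.ham_apply]
  have hb : b ∈ ⨆ m, eigenspace ρ m := hρ.iSup_eigenspace ▸ Submodule.mem_top
  induction hb using Submodule.iSup_induction' with
  | zero => simp
  | add x y _ _ hx hy => rw [map_add, LinearMap.add_apply]; exact add_mem hx hy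
  | mem m' b hb => exact Ideal.subset_span ⟨hI _ _ haI, _, bracket_mem_eigenspace hρπ hb ha⟩

variable [CharZero k]

/-- The differential of a rational torus action, as a derivation of the algebra. -/
def differentialDer (hρ : IsRational ρ) (η : Fin r → k) : Derivation k A A :=
  Derivation.mk' (differential hρ η) fun a b => by
    have ha : a ∈ ⨆ m, eigenspace ρ m := hρ.iSup_eigenspace ▸ Submodule.mem_top
    have hb : b ∈ ⨆ m, eigenspace ρ m := hρ.iSup_eigenspace ▸ Submodule.mem_top
    induction ha using Submodule.iSup_induction' with
    | zero => simp
    | add x y _ _ hx hy => rw [add_mul, map_add, hx, hy, map_add, smul_add, add_smul]; ring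
    | mem m a ha =>
      induction hb using Submodule.iSup_induction' with
      | zero => simp
      | add x y _ _ hx hy => rw [mul_add, map_add, hx, hy, map_add, smul_add, add_smul]; ring
      | mem m' b hb =>
        rw [differential_of_mem hρ η (mul_mem_eigenspace ha hb), differential_of_mem hρ η ha,
          differential_of_mem hρ η hb]
        simp only [Pi.add_apply, Int.cast_add, mul_add, Finset.sum_add_distrib, smul_eq_mul,
          add_smul, mul_smul_comm, mul_comm b a]
        rw [add_comm]

theorem differentialDer_apply (hρ : IsRational ρ) (η : Fin r → k) (a : A) :
    differentialDer hρ η a = differential hρ η a :=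
  rfl

/-- The prime Poisson ideals that are stable under the Lie algebra of the torus, the infinitesimal
version of torus-stable Poisson primes. -/
def stablePoissonPrimes (π : PoissonBracket k A) (hρ : IsRational ρ) : Set (Ideal A) :=
  {P | P.IsPrime ∧ π.IsPoissonIdeal P ∧ ∀ η, IsDifferentialIdeal (differentialDer hρ η) P}

theorem isDifferentialIdeal_homogeneousSpan (hρ : IsRational ρ) (η : Fin r → k) (I : Ideal A) :
    IsDifferentialIdeal (differentialDer hρ η) (homogeneousSpan ρ I) := by
  refine IsDifferentialIdeal.span ?_
  rintro a ⟨haI, m, ha⟩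
  rw [differentialDer_apply, differential_of_mem hρ η ha]
  exact Submodule.smul_of_tower_mem _ _ (Ideal.subset_span ⟨haI, m, ha⟩)

theorem exists_mem_stablePoissonPrimes_le (hρ : IsRational ρ)
    (hρπ : ∀ h a b, ρ h (π.bracket a b) = π.bracket (ρ h a) (ρ h b)) (Q : π.PSpec) :
    ∃ J ∈ stablePoissonPrimes π hρ, J ≤ Q.1.asIdeal ∧
      ∀ m, ∀ a ∈ eigenspace ρ m, a ∈ Q.1.asIdeal → a ∈ J := by
  obtain ⟨J, hJ, hJQ⟩ := Ideal.exists_minimalPrimes_le (I := homogeneousSpan ρ Q.1.asIdeal)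
    (J := Q.1.asIdeal) (Ideal.span_le.mpr fun a ha => ha.1)
  let : Algebra ℚ A := Algebra.compHom A (algebraMap ℚ k)
  exact ⟨J, ⟨hJ.1.1,
    π.isPoissonIdeal_of_mem_minimalPrimes (isPoissonIdeal_homogeneousSpan hρ hρπ Q.2) hJ,
    fun η => (isDifferentialIdeal_homogeneousSpan hρ η _).of_mem_minimalPrimes hJ⟩, hJQ,
    fun m a ha haQ => hJ.1.2 (Ideal.subset_span ⟨haQ, m, ha⟩)⟩

theorem dixmierMoeglinEquivalence_of_finite_stablePoissonPrimes [Algebra.FiniteType k A]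
    (hρ : IsRational ρ) (hρπ : ∀ h a b, ρ h (π.bracket a b) = π.bracket (ρ h a) (ρ h b))
    (hfin : (stablePoissonPrimes π hρ).Finite) : π.DixmierMoeglinEquivalence :=
  π.dixmierMoeglinEquivalence_of_forall_isLocallyClosed fun _ hP =>
    (isGradedBy_eigenspace hρ hρπ).isLocallyClosed_of_isPoissonRational hfin
      (exists_mem_stablePoissonPrimes_le hρ hρπ) hP

end Torus

section PolynomialIdeals

open Polynomial

section PolynomialDerivation

variable {k D : Type*} [CommRing k] [CommRing D] [Algebra k D]

/-- The derivation of `D[X]` that extends the derivation `d` of `D` and maps `X` to `x * X + y`. -/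
def polynomialDerivation (d : Derivation k D D) (x y : D) : Derivation k D[X] D[X] :=
  (PolynomialModule.equivPolynomialSelf (R := D)).toLinearMap.compDer d.mapCoeffs +
    (C x * X + C y) • (derivative' (R := D)).restrictScalars k

variable (d : Derivation k D D) (x y : D)

theorem coeff_polynomialDerivation (q : D[X]) (m : ℕ) :
    (polynomialDerivation d x y q).coeff m =
      d (q.coeff m) + x * (m * q.coeff m) + y * ((m + 1) * q.coeff (m + 1)) := by
  change (PolynomialModule.equivPolynomialSelf (d.mapCoeffs q) +
        (C x * X + C y) * derivative q).coeff m = _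
  rw [coeff_add, add_mul, coeff_add, mul_assoc, coeff_C_mul, coeff_C_mul, ← add_assoc,
    coeff_derivative, mul_comm (q.coeff (m + 1))]
  congr 3
  cases m with
  | zero => simp
  | succ m => rw [coeff_X_mul, coeff_derivative]; push_cast; ring

theorem polynomialDerivation_C (c : D) : polynomialDerivation d x y (C c) = C (d c) := by
  ext (_ | m)
  · simp [coeff_polynomialDerivation]
  · simp [coeff_polynomialDerivation, coeff_C_succ]

theorem polynomialDerivation_X : polynomialDerivation d x y X = C x * X + C y := by
  ext (_ | _ | m) <;> simp [coeff_polynomialDerivation, coeff_X, coeff_C]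

theorem natDegree_polynomialDerivation_le (q : D[X]) :
    (polynomialDerivation d x y q).natDegree ≤ q.natDegree := by
  refine natDegree_le_iff_coeff_eq_zero.mpr fun m hm => ?_
  simp [coeff_polynomialDerivation, coeff_eq_zero_of_natDegree_lt hm,
    coeff_eq_zero_of_natDegree_lt (Nat.lt_succ_of_lt hm)]

theorem coeff_natDegree_polynomialDerivation (q : D[X]) :
    (polynomialDerivation d x y q).coeff q.natDegree =
      d q.leadingCoeff + q.natDegree * x * q.leadingCoeff := by
  rw [coeff_polynomialDerivation, coeff_eq_zero_of_natDegree_lt (Nat.lt_succ_self _),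
    coeff_natDegree]
  ring

variable {d} {E : Type*} [CommRing E] [Algebra k E]

theorem polynomialDerivation_map {d' : Derivation k E E} {φ : D →+* E}
    (h : ∀ b, d' (φ b) = φ (d b)) (q : D[X]) :
    polynomialDerivation d' (φ x) (φ y) (q.map φ) = (polynomialDerivation d x y q).map φ := by
  ext m
  simp [coeff_polynomialDerivation, h]

theorem IsDifferentialIdeal.map_mapRingHom {d' : Derivation k E E} {φ : D →+* E}
    (h : ∀ b, d' (φ b) = φ (d b)) {x y : D} {J : Ideal D[X]}
    (hJ : IsDifferentialIdeal (polynomialDerivation d x y) J) :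
    IsDifferentialIdeal (polynomialDerivation d' (φ x) (φ y)) (J.map (mapRingHom φ)) := by
  refine IsDifferentialIdeal.span ?_
  rintro _ ⟨q, hq, rfl⟩
  rw [coe_mapRingHom, polynomialDerivation_map x y h]
  exact Ideal.mem_map_of_mem (mapRingHom φ) (hJ q hq)

variable [Algebra D E] {x y}

theorem aeval_polynomialDerivation {Δ : Derivation k E E}
    (h : ∀ b, Δ (algebraMap D E b) = algebraMap D E (d b)) {t : E}
    (ht : Δ t = algebraMap D E x * t + algebraMap D E y) (q : D[X]) :
    aeval t (polynomialDerivation d x y q) = Δ (aeval t q) := by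
  induction q using Polynomial.induction_on with
  | C a => rw [polynomialDerivation_C, aeval_C, aeval_C, h]
  | add p q hp hq => simp only [map_add, hp, hq]
  | monomial n a ih =>
    rw [pow_succ, ← mul_assoc]
    generalize C a * X ^ n = p at ih ⊢
    simp only [Derivation.leibniz, polynomialDerivation_X, map_mul, map_add, smul_eq_mul, aeval_X,
      aeval_C, ih, ht]

theorem IsDifferentialIdeal.comap_aeval {Δ : Derivation k E E}
    (h : ∀ b, Δ (algebraMap D E b) = algebraMap D E (d b)) {t : E}
    (ht : Δ t = algebraMap D E x * t + algebraMap D E y) {P : Ideal E}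
    (hP : IsDifferentialIdeal Δ P) :
    IsDifferentialIdeal (polynomialDerivation d x y) (P.comap (aeval (R := D) t)) := by
  intro q hq
  rw [Ideal.mem_comap, aeval_polynomialDerivation h ht]
  exact hP _ hq

theorem IsDifferentialIdeal.comap_C {J : Ideal D[X]}
    (hJ : IsDifferentialIdeal (polynomialDerivation d x y) J) :
    IsDifferentialIdeal d (J.comap C) := by
  intro c hc
  rw [Ideal.mem_comap, ← polynomialDerivation_C d x y]
  exact hJ _ hc

end PolynomialDerivation

theorem ker_mapRingHom_quotient_mk_le {B : Type*} [CommRing B] (J : Ideal B[X]) :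
    RingHom.ker (mapRingHom (Ideal.Quotient.mk (J.comap C))) ≤ J := by
  rw [ker_mapRingHom, Ideal.mk_ker]
  exact Ideal.map_comap_le

theorem comap_map_mapRingHom_quotient_mk {B : Type*} [CommRing B] (J : Ideal B[X]) :
    (J.map (mapRingHom (Ideal.Quotient.mk (J.comap C)))).comap
      (mapRingHom (Ideal.Quotient.mk (J.comap C))) = J := by
  rw [Ideal.comap_map_of_surjective _ (map_surjective _ Ideal.Quotient.mk_surjective),
    ← RingHom.ker_eq_comap_bot, sup_eq_left.mpr (ker_mapRingHom_quotient_mk_le J)]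

theorem comap_map_mapRingHom_algebraMap {D K : Type*} [CommRing D] [Field K] [Algebra D K]
    [IsFractionRing D K] {I : Ideal D[X]} (hI : I.IsPrime) (hIC : I.comap C = ⊥) :
    (I.map (mapRingHom (algebraMap D K))).comap (mapRingHom (algebraMap D K)) = I := by
  let := Polynomial.algebra D K
  let M := (nonZeroDivisors D).map (C : D →+* D[X])
  have : IsLocalization M K[X] := Polynomial.isLocalization _ _
  refine IsLocalization.under_map_of_isPrime_disjoint M K[X] hI (Set.disjoint_left.mpr ?_)
  rintro _ ⟨c, hc, rfl⟩ hcI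
  have : Nontrivial D := (algebraMap D K).domain_nontrivial
  have hc0 : c ∈ I.comap C := hcI
  rw [hIC, Ideal.mem_bot] at hc0
  exact nonZeroDivisors.ne_zero hc hc0

theorem ker_algebraMap_fractionRing_quotient {B : Type*} [CommRing B] (Q : Ideal B) :
    RingHom.ker (algebraMap B (FractionRing (B ⧸ Q))) = Q := by
  rw [IsScalarTower.algebraMap_eq B (B ⧸ Q), Ideal.Quotient.algebraMap_eq, ← RingHom.comap_ker,
    (RingHom.injective_iff_ker_eq_bot _).mp (IsFractionRing.injective (B ⧸ Q) _),
    ← RingHom.ker_eq_comap_bot, Ideal.mk_ker]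

theorem comap_map_mapRingHom_fractionRing_quotient {B : Type*} [CommRing B] {Q : Ideal B}
    {J : Ideal B[X]} [hJ : J.IsPrime] (hJQ : J.comap C = Q) :
    (J.map (mapRingHom (algebraMap B (FractionRing (B ⧸ Q))))).comap
      (mapRingHom (algebraMap B (FractionRing (B ⧸ Q)))) = J := by
  subst hJQ
  set Q := J.comap C
  set K := FractionRing (B ⧸ Q)
  let ψ := mapRingHom (Ideal.Quotient.mk Q)
  have hprime : (J.map ψ).IsPrime := Ideal.map_isPrime_of_surjective
    (map_surjective _ Ideal.Quotient.mk_surjective) (ker_mapRingHom_quotient_mk_le J)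
  have hJC : (J.map ψ).comap C = ⊥ := by
    refine eq_bot_iff.mpr fun c hc => ?_
    obtain ⟨b, rfl⟩ := Ideal.Quotient.mk_surjective c
    have hb : C b ∈ (J.map ψ).comap ψ := by simpa [ψ] using hc
    rw [comap_map_mapRingHom_quotient_mk] at hb
    exact Ideal.Quotient.eq_zero_iff_mem.mpr hb
  have hcomp : mapRingHom (algebraMap B K) = (mapRingHom (algebraMap (B ⧸ Q) K)).comp ψ := by
    rw [mapRingHom_comp, ← Ideal.Quotient.algebraMap_eq, ← IsScalarTower.algebraMap_eq]
  rw [hcomp, ← Ideal.map_map, ← Ideal.comap_comap, comap_map_mapRingHom_algebraMap hprime hJC,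
    comap_map_mapRingHom_quotient_mk]

section MonicGenerators

variable {k K : Type*} [CommRing k] [CommRing K] [Algebra k K] {d : Derivation k K K} {x y : K}

theorem polynomialDerivation_eq_of_dvd {f : K[X]} (hf : f.Monic)
    (hdvd : f ∣ polynomialDerivation d x y f) :
    polynomialDerivation d x y f = C (f.natDegree * x) * f := by
  nontriviality K
  have hcoeff : (polynomialDerivation d x y f - C (f.natDegree * x) * f).coeff f.natDegree = 0 := by
    rw [coeff_sub, coeff_natDegree_polynomialDerivation, coeff_C_mul, coeff_natDegree,
      hf.leadingCoeff, Derivation.map_one_eq_zero]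
    ring
  have hle : (polynomialDerivation d x y f - C (f.natDegree * x) * f).natDegree ≤ f.natDegree :=
    (natDegree_sub_le _ _).trans
      (max_le (natDegree_polynomialDerivation_le d x y f) (natDegree_C_mul_le _ _))
  by_contra hne
  have hlt := lt_of_le_of_ne hle fun h => sub_ne_zero.mpr hne <|
    leadingCoeff_eq_zero.mp (by rw [leadingCoeff, h, hcoeff])
  exact hf.not_dvd_of_natDegree_lt (sub_ne_zero.mpr hne) hlt (hdvd.sub (dvd_mul_left _ _))

theorem polynomialDerivation_pow_eq_of_dvd {f : K[X]} (hf : f.Monic)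
    (hdvd : f ∣ polynomialDerivation d x y f) (m : ℕ) :
    polynomialDerivation d x y (f ^ m) = C ((f.natDegree * m : ℕ) * x) * f ^ m := by
  cases m with
  | zero => simp
  | succ m =>
    rw [Derivation.leibniz_pow, polynomialDerivation_eq_of_dvd hf hdvd]
    simp only [add_tsub_cancel_right, smul_eq_mul, nsmul_eq_mul, map_mul, Nat.cast_mul,
      Nat.cast_succ, map_natCast, map_add, map_one]
    ring

end MonicGenerators

/-- Stability of an ideal `J` of `E[X]` under the derivations that control stable Poisson ideals of
a Poisson polynomial algebra `E[X; α, δ]_p`: for each `b` the extension `X ↦ α b * X + δ b` of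
`{-, b}`, and the extension `X ↦ s * X` of `α`. The elements `b` and `δ b` are only given for a ring
`D` that maps to `E`, so that `E` may be a residue field on which `δ` does not induce a map. -/
structure IsStableIdeal {k D E : Type*} [CommRing k] [CommRing D] [CommRing E] [Algebra k E]
    [Algebra D E] (σ : PoissonBracket k E) (α : Derivation k E E) (δ : D → E) (s : E)
    (J : Ideal E[X]) : Prop where
  bracket : ∀ b : D, IsDifferentialIdeal
    (polynomialDerivation (-σ.ham (algebraMap D E b)) (α (algebraMap D E b)) (δ b)) J
  derivation : IsDifferentialIdeal (polynomialDerivation α s 0) J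

section Generators

theorem leadingCoeff_polynomialDerivation_eq {k K : Type*} [CommRing k] [CommRing K] [Algebra k K]
    {d : Derivation k K K} {x y c : K} {h : K[X]} (hh : polynomialDerivation d x y h = C c * h) :
    d h.leadingCoeff + h.natDegree * x * h.leadingCoeff = c * h.leadingCoeff := by
  rw [← coeff_natDegree_polynomialDerivation, hh, coeff_C_mul, coeff_natDegree]

variable {k D K : Type*} [CommRing k] [CommRing D] [IsDomain D] [Field K] [CharZero K] [Algebra k K]
  [Algebra D K] [IsFractionRing D K] {σ : PoissonBracket k K} {α : Derivation k K K} {δ : D → K}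
  {s : K}

-- The leading coefficient `p` of `h`, of degree `m`, satisfies `{p, b} = (n - m) * p * α b` for
-- all `b` in `K`. Taking `b = p` gives `p * α p = 0`, and then `(n - m) * s * p ^ 2 = 0`.
theorem eq_zero_of_degree_lt_of_polynomialDerivation_eq (hs : s ≠ 0) {h : K[X]} {n : ℕ}
    (hn : h.degree < n)
    (hσ : ∀ b : D, polynomialDerivation (-σ.ham (algebraMap D K b)) (α (algebraMap D K b)) (δ b) h =
      C (n * α (algebraMap D K b)) * h)
    (hα : polynomialDerivation α s 0 h = C (n * s) * h) : h = 0 := by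
  by_contra hne
  set p := h.leadingCoeff with hp
  have hnm : (n : K) - h.natDegree ≠ 0 := sub_ne_zero.mpr <|
    Nat.cast_injective.ne ((natDegree_lt_iff_degree_lt hne).mpr hn).ne'
  have hbracket : σ.ham p = (((n : K) - h.natDegree) * p) • α := by
    refine Derivation.eq_of_eq_on_base D fun b => ?_
    have hb := leadingCoeff_polynomialDerivation_eq (hσ b)
    rw [← hp, Derivation.neg_apply, PoissonBracket.ham_apply, σ.skew, neg_neg] at hb
    rw [PoissonBracket.ham_apply, Derivation.smul_apply, smul_eq_mul]
    linear_combination hb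
  have hαp : p * α p = 0 := by
    have hpp := congrArg (fun d => d p) hbracket
    simp only [PoissonBracket.ham_apply, σ.self, Derivation.smul_apply, smul_eq_mul,
      mul_assoc] at hpp
    exact (mul_eq_zero.mp hpp.symm).resolve_left hnm
  have hspp : ((n : K) - h.natDegree) * s * p ^ 2 = 0 := by
    linear_combination hαp - p * leadingCoeff_polynomialDerivation_eq hα
  simp [hnm, hs, hp, hne] at hspp

theorem IsStableIdeal.pow_natDegree_eq (hs : s ≠ 0) {f g : K[X]} (hf : f.Monic) (hg : g.Monic)
    (hfI : IsStableIdeal σ α δ s (Ideal.span {f})) (hgI : IsStableIdeal σ α δ s (Ideal.span {g})) :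
    f ^ g.natDegree = g ^ f.natDegree := by
  set n := f.natDegree * g.natDegree with hn
  have derivation_sub {d : Derivation k K K} {x y : K}
      (hfd : IsDifferentialIdeal (polynomialDerivation d x y) (Ideal.span {f}))
      (hgd : IsDifferentialIdeal (polynomialDerivation d x y) (Ideal.span {g})) :
      polynomialDerivation d x y (f ^ g.natDegree - g ^ f.natDegree) =
        C (n * x) * (f ^ g.natDegree - g ^ f.natDegree) := by
    have hf_dvd : f ∣ polynomialDerivation d x y f :=
      Ideal.mem_span_singleton.mp (hfd f (Ideal.mem_span_singleton_self f))
    have hg_dvd : g ∣ polynomialDerivation d x y g :=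
      Ideal.mem_span_singleton.mp (hgd g (Ideal.mem_span_singleton_self g))
    rw [map_sub, polynomialDerivation_pow_eq_of_dvd hf hf_dvd,
      polynomialDerivation_pow_eq_of_dvd hg hg_dvd, mul_comm g.natDegree, ← hn, mul_sub]
  have hfn : (f ^ g.natDegree).degree = n := by
    rw [degree_eq_natDegree (hf.pow _).ne_zero, natDegree_pow, mul_comm]
  have hgn : (g ^ f.natDegree).degree = n := by
    rw [degree_eq_natDegree (hg.pow _).ne_zero, natDegree_pow]
  have hlt : (f ^ g.natDegree - g ^ f.natDegree).degree < n :=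
    hfn ▸ degree_sub_lt_left (hfn.trans hgn.symm) (hf.pow _).ne_zero
      ((hf.pow _).leadingCoeff.trans (hg.pow _).leadingCoeff.symm)
  exact sub_eq_zero.mp <| eq_zero_of_degree_lt_of_polynomialDerivation_eq hs hlt
    (fun b => derivation_sub (hfI.bracket b) (hgI.bracket b))
    (derivation_sub hfI.derivation hgI.derivation)

end Generators

section ResidueField

variable {k B : Type*} [CommRing k] [CommRing B] [Algebra k B] {Q : Ideal B} [Q.IsPrime]

/-- The derivation of the residue field at `Q` that a derivation with `d Q ⊆ Q` induces. -/
def residueDerivation {d : Derivation k B B} (hQ : IsDifferentialIdeal d Q) :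
    Derivation k (FractionRing (B ⧸ Q)) (FractionRing (B ⧸ Q)) :=
  Derivation.extendToFractions (FractionRing (B ⧸ Q)) <|
    (Algebra.linearMap (B ⧸ Q) (FractionRing (B ⧸ Q))).compDer <|
      Derivation.liftOfSurjective (f := Ideal.Quotient.mkₐ k Q) (d := d)
        (Ideal.Quotient.mkₐ_surjective k Q) fun b hb =>
          Ideal.Quotient.eq_zero_iff_mem.mpr (hQ b (Ideal.Quotient.eq_zero_iff_mem.mp hb))

theorem residueDerivation_algebraMap {d : Derivation k B B} (hQ : IsDifferentialIdeal d Q) (b : B) :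
    residueDerivation hQ (algebraMap B _ b) = algebraMap B (FractionRing (B ⧸ Q)) (d b) := by
  rw [residueDerivation, IsScalarTower.algebraMap_apply B (B ⧸ Q),
    Derivation.extendToFractions_algebraMap]
  exact congrArg (algebraMap (B ⧸ Q) _) (Derivation.liftOfSurjective_apply _ _ b)

theorem IsStableIdeal.isPoissonIdeal_comap_C {σ : PoissonBracket k B} {α : Derivation k B B}
    {δ : B → B} {s : B} {J : Ideal B[X]} (hJ : IsStableIdeal σ α δ s J) :
    σ.IsPoissonIdeal (J.comap C) := by
  intro b c hc
  have hbc := (hJ.bracket b).comap_C c hc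
  exact neg_mem_iff.mp hbc

theorem IsStableIdeal.map_mapRingHom_algebraMap {σ : PoissonBracket k B} {α : Derivation k B B}
    {δ : B → B} {s : B} {J : Ideal B[X]} (hJ : IsStableIdeal σ α δ s J)
    (hQ : σ.IsPoissonIdeal Q) (hQα : IsDifferentialIdeal α Q) :
    IsStableIdeal (D := B ⧸ Q) ((σ.quotient hQ).fractions (FractionRing (B ⧸ Q)))
      (residueDerivation hQα) (fun b => algebraMap B _ (δ (Quotient.out b))) (algebraMap B _ s)
      (J.map (mapRingHom (algebraMap B (FractionRing (B ⧸ Q))))) := by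
  refine ⟨fun b => ?_, ?_⟩
  · have hb : algebraMap (B ⧸ Q) (FractionRing (B ⧸ Q)) b = algebraMap B _ (Quotient.out b) := by
      rw [IsScalarTower.algebraMap_apply B (B ⧸ Q), Ideal.Quotient.algebraMap_eq,
        Ideal.Quotient.mk_out]
    rw [hb, residueDerivation_algebraMap]
    refine (hJ.bracket (Quotient.out b)).map_mapRingHom fun c => ?_
    simp only [Derivation.neg_apply, PoissonBracket.ham_apply, map_neg, neg_inj,
      IsScalarTower.algebraMap_apply B (B ⧸ Q) (FractionRing (B ⧸ Q)), ← σ.quotient_mk hQ,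
      Ideal.Quotient.algebraMap_eq]
    exact ((σ.quotient hQ).eq_fractions_iff _ _).mp rfl _ _
  · rw [← map_zero (algebraMap B _)]
    exact hJ.derivation.map_mapRingHom (residueDerivation_algebraMap hQα)

theorem exists_monic_map_mapRingHom_eq_span {J : Ideal B[X]} [J.IsPrime] (hJQ : J.comap C = Q)
    (hJ : J ≠ Q.map C) : ∃ f : (FractionRing (B ⧸ Q))[X], f.Monic ∧ f.natDegree ≠ 0 ∧
      J.map (mapRingHom (algebraMap B (FractionRing (B ⧸ Q)))) = Ideal.span {f} := by
  set K := FractionRing (B ⧸ Q)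
  have hcomap := comap_map_mapRingHom_fractionRing_quotient hJQ
  have hne : J.map (mapRingHom (algebraMap B K)) ≠ ⊥ := fun h => hJ <| le_antisymm
    (by rwa [Ideal.map_eq_bot_iff_le_ker, ker_mapRingHom,
      ker_algebraMap_fractionRing_quotient] at h) (hJQ ▸ Ideal.map_comap_le)
  obtain ⟨f, hf, hfJ⟩ := exists_monic_span _ hne
  refine ⟨f, hf, fun h0 => ‹J.IsPrime›.ne_top ?_, hfJ⟩
  rw [← hcomap, hfJ, hf.natDegree_eq_zero.mp h0, Ideal.span_singleton_one, Ideal.comap_top]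

theorem le_of_pow_natDegree_eq {K : Type*} [Field K] {φ : B →+* K} {J₁ J₂ : Ideal B[X]} [J₂.IsPrime]
    {f g : K[X]} (hf : J₁.map (mapRingHom φ) = Ideal.span {f})
    (hg : J₂.map (mapRingHom φ) = Ideal.span {g})
    (hcomap : (J₂.map (mapRingHom φ)).comap (mapRingHom φ) = J₂)
    (hfg : f ^ g.natDegree = g ^ f.natDegree) (hf0 : f.natDegree ≠ 0) : J₁ ≤ J₂ := by
  intro q hq
  have hfq : f ∣ q.map φ := Ideal.mem_span_singleton.mp (hf ▸ Ideal.mem_map_of_mem _ hq)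
  have hgq : g ∣ q.map φ ^ g.natDegree :=
    ((dvd_pow_self g hf0).trans hfg.symm.dvd).trans (pow_dvd_pow_of_dvd hfq _)
  refine ‹J₂.IsPrime›.mem_of_pow_mem g.natDegree ?_
  rw [← hcomap, Ideal.mem_comap, hg, map_pow]
  exact Ideal.mem_span_singleton.mpr hgq

end ResidueField

theorem IsStableIdeal.eq_of_comap_C_eq {k B : Type*} [Field k] [CharZero k] [CommRing B]
    [Algebra k B] {σ : PoissonBracket k B} {α : Derivation k B B} {δ : B → B} {s : B}
    {J₁ J₂ : Ideal B[X]} [J₁.IsPrime] [J₂.IsPrime] (hJ₁ : IsStableIdeal σ α δ s J₁)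
    (hJ₂ : IsStableIdeal σ α δ s J₂) (hs : s ∉ J₁.comap C) (h : J₁.comap C = J₂.comap C)
    (hJ₁C : J₁ ≠ (J₁.comap C).map C) (hJ₂C : J₂ ≠ (J₂.comap C).map C) : J₁ = J₂ := by
  set Q := J₁.comap C with hQ
  rw [← h] at hJ₂C
  have hQp := hJ₁.isPoissonIdeal_comap_C
  have hQα := hJ₁.derivation.comap_C
  set K := FractionRing (B ⧸ Q)
  have : CharZero K := charZero_of_injective_algebraMap (algebraMap k K).injective
  have hs0 : algebraMap B K s ≠ 0 := fun h0 =>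
    hs ((ker_algebraMap_fractionRing_quotient Q).le h0)
  obtain ⟨f, hf, hf0, hfJ⟩ := exists_monic_map_mapRingHom_eq_span hQ.symm hJ₁C
  obtain ⟨g, hg, hg0, hgJ⟩ := exists_monic_map_mapRingHom_eq_span h.symm hJ₂C
  have hfg : f ^ g.natDegree = g ^ f.natDegree :=
    IsStableIdeal.pow_natDegree_eq hs0 hf hg
      (hfJ ▸ hJ₁.map_mapRingHom_algebraMap hQp hQα) (hgJ ▸ hJ₂.map_mapRingHom_algebraMap hQp hQα)
  exact le_antisymm
    (le_of_pow_natDegree_eq hfJ hgJ (comap_map_mapRingHom_fractionRing_quotient h.symm) hfg hf0)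
    (le_of_pow_natDegree_eq hgJ hfJ (comap_map_mapRingHom_fractionRing_quotient rfl) hfg.symm hg0)

end PolynomialIdeals

section IteratedPoissonPolynomialAlgebras

open MvPolynomial

theorem algebraMap_mem_iff {k A : Type*} [Field k] [CommRing A] [Algebra k A] {P : Ideal A}
    (hP : P ≠ ⊤) {c : k} : algebraMap k A c ∈ P ↔ c = 0 := by
  refine ⟨fun hc => by_contra fun hc0 => hP ?_, ?_⟩
  · exact Ideal.eq_top_of_isUnit_mem P hc ((IsUnit.mk0 c hc0).map (algebraMap k A))
  · rintro rfl
    rw [map_zero]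
    exact P.zero_mem

theorem exists_aeval_eq_of_mem_supported_insert {k τ : Type*} [CommRing k] {t : Set τ} {i : τ}
    {p : MvPolynomial τ k} (hp : p ∈ supported k (insert i t)) :
    ∃ q : Polynomial (supported k t), Polynomial.aeval (X i : MvPolynomial τ k) q = p := by
  change p ∈ Algebra.adjoin k (X '' insert i t) at hp
  induction hp using Algebra.adjoin_induction with
  | mem x hx =>
    obtain ⟨j, rfl | hj, rfl⟩ := hx
    · exact ⟨Polynomial.X, Polynomial.aeval_X _⟩
    · exact ⟨Polynomial.C ⟨X j, Algebra.subset_adjoin ⟨j, hj, rfl⟩⟩, Polynomial.aeval_C _ _⟩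
  | algebraMap c => exact ⟨Polynomial.C (algebraMap k _ c), Polynomial.aeval_C _ _⟩
  | add x y _ _ hx hy =>
    obtain ⟨q, rfl⟩ := hx
    obtain ⟨q', rfl⟩ := hy
    exact ⟨q + q', map_add _ _ _⟩
  | mul x y _ _ hx hy =>
    obtain ⟨q, rfl⟩ := hx
    obtain ⟨q', rfl⟩ := hy
    exact ⟨q * q', map_mul _ _ _⟩

/-- The contraction of `P` to `k[xⱼ : j < i][xᵢ]`. -/
def contraction {k : Type*} [CommRing k] {n : ℕ} (P : Ideal (MvPolynomial (Fin n) k)) (i : Fin n) :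
    Ideal (Polynomial (supported k (Set.Iio i))) :=
  P.comap (Polynomial.aeval (X i))

/-- The indices `i` such that the contraction of `P` to `k[xⱼ : j ≤ i]` is generated by the
contraction to `k[xⱼ : j < i]`. -/
def extendedIndices {k : Type*} [CommRing k] {n : ℕ} (P : Ideal (MvPolynomial (Fin n) k)) :
    Set (Fin n) :=
  {i | contraction P i = ((contraction P i).comap Polynomial.C).map Polynomial.C}

theorem mem_comap_C_contraction {k : Type*} [CommRing k] {n : ℕ}
    {P : Ideal (MvPolynomial (Fin n) k)} {i : Fin n} {b : supported k (Set.Iio i)} :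
    b ∈ (contraction P i).comap Polynomial.C ↔ (b : MvPolynomial (Fin n) k) ∈ P := by
  simp only [contraction, Ideal.mem_comap, Polynomial.aeval_C]
  rfl

namespace IsIteratedPoissonPolynomialAlgebra

variable {k : Type*} [Field k] [CharZero k] {n r : ℕ}
  {π : PoissonBracket k (MvPolynomial (Fin n) k)}
  {α δ : ∀ i : Fin n, Derivation k (supported k (Set.Iio i)) (supported k (Set.Iio i))}
  (hA : IsIteratedPoissonPolynomialAlgebra π α δ)
  {ρ : Torus k r →* (MvPolynomial (Fin n) k ≃ₐ[k] MvPolynomial (Fin n) k)}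
  (hρ : Torus.IsRational ρ) {η : Fin n → Fin r → k}
  (hα : ∀ i j, ∀ hji : j < i, Torus.differential hρ (η i) (X j) =
    (α i ⟨X j, Algebra.subset_adjoin ⟨j, hji, rfl⟩⟩ : MvPolynomial (Fin n) k))
  (hη : ∀ i, ∃ s : k, s ≠ 0 ∧ Torus.differential hρ (η i) (X i) = s • X i)

include hα in
theorem differentialDer_eq (i : Fin n) (b : supported k (Set.Iio i)) :
    Torus.differentialDer hρ (η i) (b : MvPolynomial (Fin n) k) = α i b := by
  have eq_compDer : (Torus.differentialDer hρ (η i)).compAlgebraMap (supported k (Set.Iio i)) =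
      (Algebra.linearMap (supported k (Set.Iio i)) (MvPolynomial (Fin n) k)).compDer (α i) := by
    refine Derivation.ext_of_adjoin_eq_top _
      (Algebra.adjoin_adjoin_coe_preimage (s := X '' Set.Iio i)) ?_
    rintro ⟨_, _⟩ ⟨j, hj, rfl⟩
    exact hα i j hj
  exact congrArg (fun d => d b) eq_compDer

include hA hα

theorem isStableIdeal_contraction {P : Ideal (MvPolynomial (Fin n) k)}
    (hP : P ∈ Torus.stablePoissonPrimes π hρ) {i : Fin n} {s : k}
    (hs : Torus.differential hρ (η i) (X i) = s • X i) :
    IsStableIdeal (π.restrict (hA.isPoissonSubalgebra i)) (α i) (δ i) (algebraMap k _ s)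
      (contraction P i) := by
  refine ⟨fun b => ?_, ?_⟩
  · have hbP : IsDifferentialIdeal (-π.ham (b : MvPolynomial (Fin n) k)) P :=
      fun p hp => neg_mem (hP.2.1 b p hp)
    refine hbP.comap_aeval (fun c => rfl) ?_
    rw [Derivation.neg_apply, PoissonBracket.ham_apply, π.skew, neg_neg]
    exact hA.bracket_X i b
  · refine (hP.2.2 (η i)).comap_aeval (differentialDer_eq hρ hα i) ?_
    rw [Torus.differentialDer_apply, hs, map_zero, add_zero, ← Algebra.smul_def,
      algebraMap_smul]

include hη

theorem contraction_eq {P₁ P₂ : Ideal (MvPolynomial (Fin n) k)}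
    (hP₁ : P₁ ∈ Torus.stablePoissonPrimes π hρ) (hP₂ : P₂ ∈ Torus.stablePoissonPrimes π hρ)
    {i : Fin n} (hC : (contraction P₁ i).comap Polynomial.C = (contraction P₂ i).comap Polynomial.C)
    (hext : i ∈ extendedIndices P₁ ↔ i ∈ extendedIndices P₂) :
    contraction P₁ i = contraction P₂ i := by
  by_cases hi : i ∈ extendedIndices P₁
  · exact hi.trans ((congrArg _ hC).trans (hext.mp hi).symm)
  obtain ⟨s, hs0, hs⟩ := hη i
  have : (contraction P₁ i).IsPrime := hP₁.1.comap _
  have : (contraction P₂ i).IsPrime := hP₂.1.comap _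
  have hsC : algebraMap k _ s ∉ (contraction P₁ i).comap Polynomial.C := fun h =>
    hs0 ((algebraMap_mem_iff hP₁.1.ne_top).mp (mem_comap_C_contraction.mp h))
  exact (hA.isStableIdeal_contraction hρ hα hP₁ hs).eq_of_comap_C_eq
    (hA.isStableIdeal_contraction hρ hα hP₂ hs) hsC hC hi (hext.not.mp hi)

theorem injOn_extendedIndices : Set.InjOn extendedIndices (Torus.stablePoissonPrimes π hρ) := by
  intro P₁ hP₁ P₂ hP₂ hext
  have agree : ∀ m ≤ n, ∀ p ∈ supported k {j : Fin n | j.val < m}, p ∈ P₁ ↔ p ∈ P₂ := by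
    intro m hm
    induction m with
    | zero =>
      intro p hp
      simp only [Nat.not_lt_zero, Set.ofPred_false, supported_empty] at hp
      obtain ⟨c, rfl⟩ := Algebra.mem_bot.mp hp
      rw [algebraMap_mem_iff hP₁.1.ne_top, algebraMap_mem_iff hP₂.1.ne_top]
    | succ i ih =>
      have insert_eq : {j : Fin n | j.val < i + 1} = insert ⟨i, hm⟩ (Set.Iio ⟨i, hm⟩) := by
        rw [Set.Iio_insert]
        ext j
        exact Nat.lt_succ_iff
      intro p hp
      rw [insert_eq] at hp
      obtain ⟨q, rfl⟩ := exists_aeval_eq_of_mem_supported_insert hp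
      have hC : (contraction P₁ ⟨i, hm⟩).comap Polynomial.C =
          (contraction P₂ ⟨i, hm⟩).comap Polynomial.C := by
        ext b
        rw [mem_comap_C_contraction, mem_comap_C_contraction]
        exact ih (Nat.le_of_succ_le hm) b b.2
      exact Ideal.ext_iff.mp
        (hA.contraction_eq hρ hα hη hP₁ hP₂ hC (Set.ext_iff.mp hext _)) q
  ext p
  refine agree n le_rfl p ?_
  simp [supported_univ]

theorem finite_stablePoissonPrimes : (Torus.stablePoissonPrimes π hρ).Finite :=
  Set.Finite.of_finite_image (Set.toFinite _) (hA.injOn_extendedIndices hρ hα hη)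

end IsIteratedPoissonPolynomialAlgebra

end IteratedPoissonPolynomialAlgebras

end

theorem corollary1p8_general {k : Type*} [Field k] [CharZero k] {n r : ℕ}
    (π : PoissonBracket k (MvPolynomial (Fin n) k))
    (α δ : ∀ i : Fin n, Derivation k (MvPolynomial.supported k (Set.Iio i))
      (MvPolynomial.supported k (Set.Iio i)))
    (hA : IsIteratedPoissonPolynomialAlgebra π α δ)
    (ρ : Torus k r →* (MvPolynomial (Fin n) k ≃ₐ[k] MvPolynomial (Fin n) k))
    (hρ : Torus.IsRational ρ)
    (hρπ : ∀ h a b, ρ h (π.bracket a b) = π.bracket (ρ h a) (ρ h b))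
    (η : Fin n → Fin r → k)
    (hα : ∀ i j, ∀ hji : j < i,
      Torus.differential hρ (η i) (MvPolynomial.X j) =
        (α i ⟨MvPolynomial.X j, Algebra.subset_adjoin ⟨j, hji, rfl⟩⟩ : MvPolynomial (Fin n) k))
    (hη : ∀ i, ∃ s : k, s ≠ 0 ∧
      Torus.differential hρ (η i) (MvPolynomial.X i) = s • MvPolynomial.X i) :
    π.DixmierMoeglinEquivalence :=
  Torus.dixmierMoeglinEquivalence_of_finite_stablePoissonPrimes hρ hρπ
    (hA.finite_stablePoissonPrimes hρ hα hη)

theorem corollary1p8 {k : Type*} [Field k] [CharZero k] {n r : ℕ}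
    (π : PoissonBracket k (MvPolynomial (Fin n) k))
    (α δ : ∀ i : Fin n, Derivation k (MvPolynomial.supported k (Set.Iio i))
      (MvPolynomial.supported k (Set.Iio i)))
    (hA : IsIteratedPoissonPolynomialAlgebra π α δ)
    (ρ : Torus k r →* (MvPolynomial (Fin n) k ≃ₐ[k] MvPolynomial (Fin n) k))
    (hρ : Torus.IsRational ρ)
    (hρπ : ∀ h a b, ρ h (π.bracket a b) = π.bracket (ρ h a) (ρ h b))
    (hX : ∀ i, Torus.IsEigenvector ρ (MvPolynomial.X i))
    (η : Fin n → Fin r → k)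
    (hα : ∀ i j, ∀ hji : j < i,
      Torus.differential hρ (η i) (MvPolynomial.X j) =
        (α i ⟨MvPolynomial.X j, Algebra.subset_adjoin ⟨j, hji, rfl⟩⟩ : MvPolynomial (Fin n) k))
    (hη : ∀ i, ∃ s : k, s ≠ 0 ∧
      Torus.differential hρ (η i) (MvPolynomial.X i) = s • MvPolynomial.X i) :
    π.DixmierMoeglinEquivalence :=
  corollary1p8_general π α δ hA ρ hρ hρπ η hα hη
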